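/- Fix a universal prefix-free machine $U$, that is, a prefix-free Turing machine on binary strings such that for every prefix-free partial computable $M:\subseteq 2^{<\omega}\to 2^{<\omega}$ there is a constant $c$ for which every $\tau=M(\sigma)$ has a $U$-program of length at most $|\sigma|+c$. For $\tau\in 2^{<\omega}$ and a time bound $t$ (a total non-decreasing function $t:\omega\to\omega$), let $$K(\tau)=\min\{|\sigma| : U(\sigma){\downarrow}=\tau\},\qquad K^t(\tau)=\min\{|\sigma| : U(\sigma){\downarrow}=\tau \text{ in at most } t(|\tau|) \text{ steps}\},$$ with $\min\emptyset=\infty$. A sequence $Y\in 2^\omega$ is strongly deep if $K^t(Y{\upharpoonright}n)-K(Y{\upharpoonright}n)\to\infty$ as $n\to\infty$ for every computable time bound $t$. A Turing functional $\Phi$ is given by a c.e. set $S_\Phi$ of pairs of binary strings such that if $(\sigma,\tau),(\sigma',\tau')\in S_\Phi$ and $\sigma\preceq\sigma'$, then $\tau$ and $\tau'$ are comparable; $\Phi^X=Y\in 2^\omega$ means that the strings $\tau$ with $(X{\upharpoonright}m,\tau)\in S_\Phi$ for some $m$ are all initial segments of $Y$ and are of unbounded length. Theorem. The class of strongly deep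 sequences is negligible. That is, for the Lebesgue (fair coin) measure $\lambda$ on $2^\omega$, $$\lambda\big(\{X\in 2^\omega : \text{there is a Turing functional } \Phi \text{ such that } \Phi^X\in 2^\omega \text{ and } \Phi^X \text{ is strongly deep}\}\big)=0.$$ -/

import Mathlib

open MeasureTheory Filter Topology

namespace DeepSeq

/-- Cantor space: infinite binary sequences. -/
abbrev Cantor : Type := ℕ → Bool

/-- The string formed by the first `n` bits of `X`. -/
def restrict (X : Cantor) (n : ℕ) : List Bool := (List.range n).map X

/-- Lebesgue (fair coin) measure on Cantor space: the product of the uniform measures on bits. -/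
noncomputable def lebesgue : Measure Cantor :=
  Measure.infinitePi fun _ : ℕ => (PMF.uniformOfFintype Bool).toMeasure

/-! ### Turing functionals and negligibility -/

/-- A Turing functional: a c.e. set of pairs of strings `(σ, τ)`, read as "with an oracle extending
`σ`, the output extends `τ`", whose outputs on comparable oracle strings are comparable. -/
structure TuringFunctional where
  graph : Set (List Bool × List Bool)
  re : REPred fun p : List Bool × List Bool => p ∈ graph
  consistent : ∀ σ σ' τ τ' : List Bool, (σ, τ) ∈ graph → (σ', τ') ∈ graph → σ <+: σ' →
    τ <+: τ' ∨ τ' <+: τ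

/-- The output of `Φ` with oracle `X` is the infinite sequence `Y`: the strings that `Φ` outputs
along `X` are initial segments of `Y`, and there are arbitrarily long ones. -/
def TuringFunctional.Maps (Φ : TuringFunctional) (X Y : Cantor) : Prop :=
  (∀ (m : ℕ) (τ : List Bool), (restrict X m, τ) ∈ Φ.graph → τ = restrict Y τ.length) ∧
    ∀ n : ℕ, ∃ (m : ℕ) (τ : List Bool), (restrict X m, τ) ∈ Φ.graph ∧ n ≤ τ.length

/-- A class of sequences is negligible if the set of oracles that compute some member of it has
Lebesgue measure zero. -/
def Negligible (A : Set Cantor) : Prop :=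
  lebesgue {X | ∃ (Φ : TuringFunctional) (Y : Cantor), Φ.Maps X Y ∧ Y ∈ A} = 0

/-! ### Prefix-free machines and Kolmogorov complexity -/

/-- A Turing machine (with finitely many stacks, finitely many states and finite alphabets) that
reads and writes binary strings. -/
structure Machine extends Turing.TM2ComputableAux Bool Bool where
  finite_alphabets : ∀ k : tm.K, Finite (tm.Γ k)

namespace Machine

/-- On input `σ`, the machine `U` halts with output `τ` after at most `s` computation steps. -/
def OutputsIn (U : Machine) (σ τ : List Bool) (s : ℕ) : Prop :=
  Nonempty (Turing.TM2OutputsInTime U.tm (σ.map U.inputAlphabet.symm)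
    (some (τ.map U.outputAlphabet.symm)) s)

/-- On input `σ`, the machine `U` halts with output `τ`. -/
def Outputs (U : Machine) (σ τ : List Bool) : Prop := ∃ s : ℕ, U.OutputsIn σ τ s

/-- No input on which `U` converges is a proper prefix of another one. -/
def PrefixFree (U : Machine) : Prop :=
  ∀ σ ρ τ τ' : List Bool, U.Outputs σ τ → U.Outputs ρ τ' → σ <+: ρ → σ = ρ

/-- `U` is a universal prefix-free machine: it is prefix-free, and it simulates every partial
computable prefix-free function on strings with programs longer by at most a constant. -/
def IsUniversal (U : Machine) : Prop :=
  U.PrefixFree ∧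
    ∀ f : List Bool →. List Bool, Partrec f →
      (∀ σ ρ : List Bool, (f σ).Dom → (f ρ).Dom → σ <+: ρ → σ = ρ) →
      ∃ c : ℕ, ∀ σ τ : List Bool, τ ∈ f σ →
        ∃ σ' : List Bool, U.Outputs σ' τ ∧ σ'.length ≤ σ.length + c

/-- Prefix-free complexity: the least length of a `U`-program for `τ` (`⊤` if there is none). -/
noncomputable def complexity (U : Machine) (τ : List Bool) : ℕ∞ :=
  ⨅ (σ : List Bool) (_ : U.Outputs σ τ), (σ.length : ℕ∞)

/-- Time-bounded complexity: the least length of a `U`-program that outputs `τ` within `t |τ|`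
steps (`⊤` if there is none). -/
noncomputable def timeComplexity (U : Machine) (t : ℕ → ℕ) (τ : List Bool) : ℕ∞ :=
  ⨅ (σ : List Bool) (_ : U.OutputsIn σ τ (t τ.length)), (σ.length : ℕ∞)

end Machine

/-- `Y` is strongly deep: for every computable (total, non-decreasing) time bound `t`, the
difference between the `t`-time-bounded and the unbounded complexity of the first `n` bits of `Y`
tends to infinity. -/
def StronglyDeep (U : Machine) (Y : Cantor) : Prop :=
  ∀ t : ℕ → ℕ, Computable t → Monotone t →
    Tendsto (fun n : ℕ => U.timeComplexity t (restrict Y n) - U.complexity (restrict Y n))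
      atTop (𝓝 (⊤ : ℕ∞))

end DeepSeq

/-! There are countably many functionals, so fix `Φ` and let `D` be the set of oracles with which it
produces strings of every length. A rational `a / b` just below the measure of `D` lets one compute
stages `m n` at which strings of length `n` are already produced with probability more than `a / b`
(`Enumerates.exists_computable_stage`). For most oracles in `D` and large `n`, the output of length
`n` is therefore sampled from a computable subprobability `P_n`, and Shannon–Fano codes for such a
distribution are computably decodable and, with high probability, nearly optimal.

In detail, let the `n`-th entry in a computable list of halting computations be a program of length
`d`. Requesting each `τ` of length `n` with length about `d - log P_n(τ)` has total weight at most
one over all `n` (`Enumerates.tsum_outputRequests_le`). The requests form a total computable list,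
so the search for the programs serving them is bounded by a computable function, which yields one
time bound `t` with `K^t(τ) ≤ d - log P_n(τ) + O(1)` (`UniversalRequests.exists_time_bound`).

Conversely, the `P_n`-probability that `τ` has a program shorter than this by more than `A` is at
most a constant times `2 ^ (-A) * 2 ^ d * M_n`, where `M_n` is the total weight of programs for
strings of length `n` (`lebesgue_compressible_le`). This is useful for those `n` with `2 ^ d * M_n`
bounded, and infinitely many exist (`UniversalRequests.frequently_lengthMass_le`): if computation
`n` is by a shortest program for its output, an `M_n` far above `2 ^ (-d)` would be noticed during
enumeration and could pay for a still shorter program.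

At such lengths `K^t - K` is bounded outside a set of oracles of small measure. A deep output must
avoid this at all but finitely many of them, so `lebesgue_deepOracles_le` bounds the measure of the
oracles with deep output by an arbitrarily small number. `Machine.exists_universalRequests` reduces
stack machines to lists of requests; universality is applied to such lists through `kraftChaitin`.
-/

open scoped ENNReal

namespace DeepSeq

/-! ### Simulating a stack machine by a primitive recursive function -/

section Simulation

variable {K Λ σ : Type} {Γ : K → Type} {n g a b : ℕ}

/-- Stacks coded with a single finite alphabet. -/
def codeStacks (eK : K ≃ Fin n) (eG : (Σ k, Γ k) ≃ Fin g) (S : ∀ k, List (Γ k)) :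
    Fin n → List (Fin g) :=
  fun i => (S (eK.symm i)).map fun x => eG ⟨_, x⟩

/-- Configurations coded with finite ordinals. -/
def codeCfg (eK : K ≃ Fin n) (eG : (Σ k, Γ k) ≃ Fin g) (eL : Λ ≃ Fin a) (eS : σ ≃ Fin b)
    (c : Turing.TM2.Cfg Γ Λ σ) : Option (Fin a) × Fin b × (Fin n → List (Fin g)) :=
  (c.l.map eL, eS c.var, codeStacks eK eG c.stk)

theorem codeStacks_injective (eK : K ≃ Fin n) (eG : (Σ k, Γ k) ≃ Fin g) :
    Function.Injective (codeStacks eK eG) := by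
  intro S T h
  funext k
  have := congrFun h (eK k)
  simp only [codeStacks] at this
  rw [eK.symm_apply_apply] at this
  exact List.map_injective_iff.2
    (fun x y hxy => by simpa using eG.injective hxy) this

theorem codeCfg_injective (eK : K ≃ Fin n) (eG : (Σ k, Γ k) ≃ Fin g) (eL : Λ ≃ Fin a)
    (eS : σ ≃ Fin b) : Function.Injective (codeCfg eK eG eL eS) := by
  rintro ⟨l, v, S⟩ ⟨l', v', S'⟩ h
  simp only [codeCfg, Prod.mk.injEq] at h
  obtain ⟨h1, h2, h3⟩ := h
  have h1 := Option.map_injective eL.injective h1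
  have h2 := eS.injective h2
  have h3 := codeStacks_injective eK eG h3
  subst h1 h2 h3
  rfl

theorem primrec_update_const {α : Type} [Primcodable α] (i : Fin n) :
    Primrec fun p : (Fin n → α) × α => Function.update p.1 i p.2 := by
  refine Primrec.fin_curry.2 ?_
  refine Primrec.of_eq (f := fun q : ((Fin n → α) × α) × Fin n =>
    if q.2 = i then q.1.2 else q.1.1 q.2) ?_ ?_
  · exact Primrec.ite (Primrec.eq.comp Primrec.snd (Primrec.const i))
      (Primrec.snd.comp Primrec.fst)
      (Primrec.fin_app.comp (Primrec.fst.comp Primrec.fst) Primrec.snd)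
  · rintro ⟨⟨f, x⟩, j⟩
    by_cases h : j = i <;> simp [h]

theorem codeStacks_update [DecidableEq K] (eK : K ≃ Fin n) (eG : (Σ k, Γ k) ≃ Fin g) (S : ∀ k, List (Γ k)) (k : K)
    (l : List (Γ k)) :
    codeStacks eK eG (Function.update S k l) =
      Function.update (codeStacks eK eG S) (eK k) (l.map fun x => eG ⟨k, x⟩) := by
  funext i
  obtain ⟨k', rfl⟩ := eK.surjective i
  by_cases h : k' = k
  · subst h
    rw [Function.update_self]
    simp only [codeStacks]
    rw [eK.symm_apply_apply]
    simp
  · rw [Function.update_of_ne (fun e => h (eK.injective e))]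
    simp only [codeStacks]
    rw [eK.symm_apply_apply, Function.update_of_ne h]

theorem codeStacks_apply (eK : K ≃ Fin n) (eG : (Σ k, Γ k) ≃ Fin g) (S : ∀ k, List (Γ k)) (k : K) :
    codeStacks eK eG S (eK k) = (S k).map fun x => eG ⟨k, x⟩ := by
  simp only [codeStacks]
  rw [eK.symm_apply_apply]

open scoped Classical in
/-- Read a coded letter as a letter of the stack `k`. -/
noncomputable def decodeLetter (eG : (Σ k, Γ k) ≃ Fin g) (k : K) (x : Fin g) : Option (Γ k) :=
  if h : (eG.symm x).1 = k then some (h ▸ (eG.symm x).2) else none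

theorem decodeLetter_code (eG : (Σ k, Γ k) ≃ Fin g) (k : K) (y : Γ k) :
    decodeLetter eG k (eG ⟨k, y⟩) = some y := by
  have : eG.symm (eG ⟨k, y⟩) = ⟨k, y⟩ := eG.symm_apply_apply _
  unfold decodeLetter
  rw [this]
  simp

/-- The functions carried by a statement act only on finite types once letters and states are coded,
so `Primrec.dom_finite` applies to them; the stacks change only by `cons` and `tail`. Induction on
the statement then suffices. -/
theorem exists_primrec_stepAux [DecidableEq K] (eK : K ≃ Fin n) (eG : (Σ k, Γ k) ≃ Fin g) (eL : Λ ≃ Fin a)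
    (eS : σ ≃ Fin b) (q : Turing.TM2.Stmt Γ Λ σ) :
    ∃ F : Fin b × (Fin n → List (Fin g)) → Option (Fin a) × Fin b × (Fin n → List (Fin g)),
      Primrec F ∧ ∀ v S, F (eS v, codeStacks eK eG S) =
        codeCfg eK eG eL eS (Turing.TM2.stepAux q v S) := by
  have hst : ∀ k : K, Primrec fun p : Fin b × (Fin n → List (Fin g)) => p.2 (eK k) := fun k =>
    Primrec.fin_app.comp Primrec.snd (Primrec.const (eK k))
  have hread : ∀ (k : K) (f : σ → Option (Γ k) → σ),
      ∃ R : Fin b × (Fin n → List (Fin g)) → Fin b, Primrec R ∧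
        ∀ v S, R (eS v, codeStacks eK eG S) = eS (f v (S k).head?) := by
    intro k f
    refine ⟨fun p => (fun r : Fin b × Option (Fin g) =>
      eS (f (eS.symm r.1) (r.2.bind (decodeLetter eG k)))) (p.1, (p.2 (eK k)).head?), ?_, ?_⟩
    · exact (Primrec.dom_finite (fun r : Fin b × Option (Fin g) =>
        eS (f (eS.symm r.1) (r.2.bind (decodeLetter eG k))))).comp
        (Primrec.pair Primrec.fst (Primrec.list_head?.comp (hst k)))
    · intro v S
      simp only [codeStacks_apply, Equiv.symm_apply_apply]
      cases S k <;> simp [decodeLetter_code]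
  induction q with
  | push k f q ih =>
    obtain ⟨F, hF, hF'⟩ := ih
    refine ⟨fun p => F (p.1, Function.update p.2 (eK k)
      ((fun v => eG ⟨k, f (eS.symm v)⟩) p.1 :: p.2 (eK k))), ?_, ?_⟩
    · exact hF.comp (Primrec.pair Primrec.fst ((primrec_update_const (eK k)).comp
        (Primrec.pair Primrec.snd (Primrec.list_cons.comp
          ((Primrec.dom_finite fun v => eG ⟨k, f (eS.symm v)⟩).comp Primrec.fst) (hst k)))))
    · intro v S
      simp only [Turing.TM2.stepAux]
      rw [← hF', codeStacks_update]
      simp [codeStacks_apply]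
  | peek k f q ih =>
    obtain ⟨F, hF, hF'⟩ := ih
    obtain ⟨R, hR, hR'⟩ := hread k f
    refine ⟨fun p => F (R p, p.2), hF.comp (Primrec.pair hR Primrec.snd), ?_⟩
    intro v S
    simp only [Turing.TM2.stepAux]
    rw [← hF', hR']
  | pop k f q ih =>
    obtain ⟨F, hF, hF'⟩ := ih
    obtain ⟨R, hR, hR'⟩ := hread k f
    refine ⟨fun p => F (R p, Function.update p.2 (eK k) (p.2 (eK k)).tail), ?_, ?_⟩
    · exact hF.comp (Primrec.pair hR ((primrec_update_const (eK k)).comp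
        (Primrec.pair Primrec.snd (Primrec.list_tail.comp (hst k)))))
    · intro v S
      simp only [Turing.TM2.stepAux]
      rw [← hF', hR', codeStacks_update, codeStacks_apply, List.map_tail]
  | load f q ih =>
    obtain ⟨F, hF, hF'⟩ := ih
    refine ⟨fun p => F ((fun v => eS (f (eS.symm v))) p.1, p.2),
      hF.comp (Primrec.pair ((Primrec.dom_finite fun v => eS (f (eS.symm v))).comp Primrec.fst)
        Primrec.snd), ?_⟩
    intro v S
    simp only [Turing.TM2.stepAux]
    rw [← hF']
    simp
  | branch f q₁ q₂ ih₁ ih₂ =>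
    obtain ⟨F, hF, hF'⟩ := ih₁
    obtain ⟨G, hG, hG'⟩ := ih₂
    refine ⟨fun p => cond ((fun v => f (eS.symm v)) p.1) (F p) (G p),
      Primrec.cond ((Primrec.dom_finite fun v => f (eS.symm v)).comp Primrec.fst) hF hG, ?_⟩
    intro v S
    simp only [Turing.TM2.stepAux, Equiv.symm_apply_apply]
    cases f v <;> simp [hF', hG']
  | goto f =>
    refine ⟨fun p => ((fun v => some (eL (f (eS.symm v)))) p.1, p.1, p.2),
      Primrec.pair ((Primrec.dom_finite fun v => some (eL (f (eS.symm v)))).comp Primrec.fst)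
        Primrec.id, ?_⟩
    intro v S
    simp [Turing.TM2.stepAux, codeCfg]
  | halt =>
    refine ⟨fun p => (none, p.1, p.2), Primrec.pair (Primrec.const none) Primrec.id, ?_⟩
    intro v S
    simp [Turing.TM2.stepAux, codeCfg]

theorem exists_primrec_step [DecidableEq K] (eK : K ≃ Fin n) (eG : (Σ k, Γ k) ≃ Fin g) (eL : Λ ≃ Fin a)
    (eS : σ ≃ Fin b) (M : Λ → Turing.TM2.Stmt Γ Λ σ) :
    ∃ F : Option (Fin a) × Fin b × (Fin n → List (Fin g)) →
        Option (Option (Fin a) × Fin b × (Fin n → List (Fin g))),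
      Primrec F ∧ ∀ c, F (codeCfg eK eG eL eS c) =
        (Turing.TM2.step M c).map (codeCfg eK eG eL eS) := by
  choose F hF hF' using fun l : Fin a => exists_primrec_stepAux eK eG eL eS (M (eL.symm l))
  refine ⟨fun c => c.1.bind fun l => some (F l c.2), ?_, ?_⟩
  · refine Primrec.option_bind Primrec.fst ?_
    exact Primrec.option_some.comp ((Primrec.fin_curry₁.2 hF).comp Primrec.snd
      (Primrec.snd.comp Primrec.fst))
  · rintro ⟨_ | l, v, S⟩
    · simp [codeCfg, Turing.TM2.step]
    · simp [codeCfg, Turing.TM2.step, hF']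

end Simulation

/-- `O σ s` answers only at the exact step `s` of halting. The last clause ensures that a program is
counted once when the weights of all halting computations are summed. -/
theorem Machine.exists_primrec_output (U : Machine) :
    ∃ O : List Bool → ℕ → Option (List Bool), Primrec₂ O ∧
      (∀ σ τ S, U.OutputsIn σ τ S ↔ ∃ s ≤ S, O σ s = some τ) ∧
      ∀ σ s s', (O σ s).isSome → (O σ s').isSome → s = s' := by
  classical
  let tm := U.tm
  have := tm.kFin
  have := tm.ΛFin
  have := tm.σFin
  have := U.finite_alphabets
  obtain ⟨n, ⟨eK⟩⟩ := Finite.exists_equiv_fin tm.K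
  obtain ⟨g, ⟨eG⟩⟩ := Finite.exists_equiv_fin (Σ k, tm.Γ k)
  obtain ⟨a, ⟨eL⟩⟩ := Finite.exists_equiv_fin tm.Λ
  obtain ⟨b, ⟨eS⟩⟩ := Finite.exists_equiv_fin tm.σ
  obtain ⟨F, hF, hF'⟩ := exists_primrec_step eK eG eL eS tm.m
  let code : tm.Cfg → _ := codeCfg eK eG eL eS
  have hcode : Function.Injective code := codeCfg_injective eK eG eL eS
  let run : tm.Cfg → ℕ → Option tm.Cfg := fun c s => (flip Bind.bind tm.step)^[s] (some c)
  have hiter : ∀ (c : tm.Cfg) (s : ℕ),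
      (fun o : Option _ => o.bind F)^[s] (some (code c)) = (run c s).map code := by
    intro c s
    induction s with
    | zero => rfl
    | succ s ih =>
      simp only [run] at ih ⊢
      rw [Function.iterate_succ_apply', ih, Function.iterate_succ_apply']
      rcases (flip Bind.bind tm.step)^[s] (some c) with _ | d
      · rfl
      · exact hF' d
  -- The hypothesis repeats the bodies of `Turing.initList` and `Turing.haltList`, cast included, so
  -- that `rfl` proves it for both.
  have hstk : ∀ (k : tm.K) (l : List (tm.Γ k)) (S : ∀ k, List (tm.Γ k)),
      (∀ k', S k' = @dite (List (tm.Γ k')) (k' = k) (tm.kDecidableEq k' k)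
        (fun h => by rw [h]; exact l) fun _ => []) →
      codeStacks eK eG S = fun i => if i = eK k then l.map (fun x => eG ⟨k, x⟩) else [] := by
    intro k l S hS
    funext i
    obtain ⟨k', rfl⟩ := eK.surjective i
    rw [codeStacks_apply, hS]
    by_cases h : k' = k
    · subst h; simp
    · simp [h]
  have hprim : ∀ (k : tm.K) (e : Bool → tm.Γ k) (o : Option (Fin a)), Primrec fun σ : List Bool =>
      ((o, eS tm.initialState, fun i => if i = eK k then
        (σ.map e).map (fun x => eG ⟨k, x⟩) else []) :
        Option (Fin a) × Fin b × (Fin n → List (Fin g))) := by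
    intro k e o
    refine Primrec.pair (Primrec.const _) (Primrec.pair (Primrec.const _)
      (Primrec.fin_curry.2 ?_))
    refine Primrec.of_eq (f := fun p : List Bool × Fin n =>
      if p.2 = eK k then p.1.map (fun x => eG ⟨k, e x⟩) else []) ?_ ?_
    · exact Primrec.ite (Primrec.eq.comp Primrec.snd (Primrec.const _))
        (Primrec.list_map Primrec.fst
          ((Primrec.dom_bool fun x => eG ⟨k, e x⟩).comp Primrec.snd).to₂)
        (Primrec.const [])
    · rintro ⟨σ, i⟩
      simp [Function.comp_def]
  let inp : List Bool → _ := fun σ => code (Turing.initList tm (σ.map U.inputAlphabet.symm))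
  let out : List Bool → _ := fun τ => code (Turing.haltList tm (τ.map U.outputAlphabet.symm))
  have hinp : Primrec inp := by
    refine (hprim tm.k₀ U.inputAlphabet.symm (some (eL tm.main))).of_eq fun σ => ?_
    exact Prod.ext rfl (Prod.ext rfl (hstk tm.k₀ _ (Turing.initList tm _).stk fun _ => rfl).symm)
  have hout : Primrec out := by
    refine (hprim tm.k₁ U.outputAlphabet.symm none).of_eq fun σ => ?_
    exact Prod.ext rfl (Prod.ext rfl (hstk tm.k₁ _ (Turing.haltList tm _).stk fun _ => rfl).symm)
  let dec : Fin g → Bool := fun x => ((decodeLetter eG tm.k₁ x).map U.outputAlphabet).getD false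
  let rd : Option (Fin a) × Fin b × (Fin n → List (Fin g)) → List Bool :=
    fun c => (c.2.2 (eK tm.k₁)).map dec
  have hrd : Primrec rd :=
    Primrec.list_map (Primrec.fin_app.comp (Primrec.snd.comp Primrec.snd) (Primrec.const _))
      ((Primrec.dom_finite dec).comp Primrec.snd)
  have hrdout : ∀ τ, rd (out τ) = τ := by
    intro τ
    have h := congrFun (hstk tm.k₁ (τ.map U.outputAlphabet.symm)
      (Turing.haltList tm (τ.map U.outputAlphabet.symm)).stk fun _ => rfl) (eK tm.k₁)
    refine (congrArg (List.map dec) h).trans ?_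
    simp only [if_true, List.map_map]
    rw [List.map_congr_left (g := id), List.map_id]
    intro x _
    simp [dec, decodeLetter_code]
  -- `OutputsIn` requires the whole halting configuration: initial internal state and all other
  -- stacks empty. Hence the test that the word read from the output stack reproduces the
  -- configuration.
  let O : List Bool → ℕ → Option (List Bool) := fun σ s =>
    ((fun o : Option _ => o.bind F)^[s] (some (inp σ))).bind fun c =>
      if c = out (rd c) then some (rd c) else none
  have hO : ∀ σ s τ, O σ s = some τ ↔
      run (Turing.initList tm (σ.map U.inputAlphabet.symm)) s =
        some (Turing.haltList tm (τ.map U.outputAlphabet.symm)) := by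
    intro σ s τ
    simp only [O, inp, hiter]
    constructor
    · intro h
      obtain ⟨c, hc, h⟩ := Option.bind_eq_some_iff.1 h
      obtain ⟨d, hd, rfl⟩ := Option.map_eq_some_iff.1 hc
      split_ifs at h with h1
      simp only [Option.some.injEq] at h
      rw [h] at h1
      rw [hd, hcode h1]
    · intro h
      rw [h]
      have : code (Turing.haltList tm (τ.map U.outputAlphabet.symm)) = out τ := rfl
      simp [this, hrdout]
  refine ⟨O, ?_, ?_, ?_⟩
  · refine Primrec.option_bind ?_ ?_
    · refine Primrec.nat_iterate Primrec.snd (Primrec.option_some.comp (hinp.comp Primrec.fst)) ?_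
      exact Primrec.option_bind Primrec.snd (hF.comp Primrec.snd)
    · exact Primrec.ite (Primrec.eq.comp Primrec.snd (hout.comp (hrd.comp Primrec.snd)))
        (Primrec.option_some.comp (hrd.comp Primrec.snd)) (Primrec.const none)
  · intro σ τ S
    constructor
    · rintro ⟨⟨⟨s, hs⟩, hle⟩⟩
      exact ⟨s, hle, (hO _ _ _).2 hs⟩
    · rintro ⟨s, hle, hs⟩
      exact ⟨⟨⟨s, (hO _ _ _).1 hs⟩, hle⟩⟩
  -- A halting configuration has no successor, so the run is `none` ever after.
  · have hhalt : ∀ (c : tm.Cfg) (s d : ℕ) (l : List (tm.Γ tm.k₁)),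
        run c s = some (Turing.haltList tm l) → run c (s + (d + 1)) = none := by
      intro c s d l h
      induction d with
      | zero =>
        simp only [run] at h ⊢
        rw [zero_add, Function.iterate_succ_apply', h]
        rfl
      | succ d ih =>
        simp only [run] at ih ⊢
        rw [← add_assoc, Function.iterate_succ_apply', ih]
        rfl
    have hlt : ∀ σ s s', (O σ s).isSome → (O σ s').isSome → ¬ s < s' := by
      intro σ s s' h h' hlt
      obtain ⟨τ, h⟩ := Option.isSome_iff_exists.1 h
      obtain ⟨τ', h'⟩ := Option.isSome_iff_exists.1 h'
      rw [hO] at h h'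
      obtain ⟨d, rfl⟩ := Nat.exists_eq_add_of_lt hlt
      rw [add_assoc, hhalt _ _ _ _ h] at h'
      cases h'
    intro σ s s' h h'
    exact le_antisymm (not_lt.1 (hlt σ s' s h' h)) (not_lt.1 (hlt σ s s' h h'))

/-! ### Computability of bounded sums and decisions -/

section Computability

variable {α β : Type*} [Primcodable α] [Primcodable β]

theorem computable_decide_eq [DecidableEq β] {f g : α → β} (hf : Computable f)
    (hg : Computable g) : Computable fun a => decide (f a = g a) :=
  (Primrec.eq.decide.to_comp).comp hf hg

theorem computable_decide_lt {f g : α → ℕ} (hf : Computable f) (hg : Computable g) :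
    Computable fun a => decide (f a < g a) :=
  (Primrec.nat_lt.decide.to_comp).comp hf hg

theorem computable_decide_le {f g : α → ℕ} (hf : Computable f) (hg : Computable g) :
    Computable fun a => decide (f a ≤ g a) :=
  (Primrec.nat_le.decide.to_comp).comp hf hg

theorem computable_decide_and {p q : α → Prop} [DecidablePred p] [DecidablePred q]
    (hp : Computable fun a => decide (p a)) (hq : Computable fun a => decide (q a)) :
    Computable fun a => decide (p a ∧ q a) :=
  ((Primrec.and.to_comp).comp hp hq).of_eq fun a => by simp

theorem computable_decide_not {p : α → Prop} [DecidablePred p]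
    (hp : Computable fun a => decide (p a)) : Computable fun a => decide (¬ p a) :=
  (Primrec.not.to_comp.comp hp).of_eq fun a => by simp

theorem computable_ite {c : α → Prop} [DecidablePred c] {f g : α → β}
    (hc : Computable fun a => decide (c a)) (hf : Computable f) (hg : Computable g) :
    Computable fun a => if c a then f a else g a :=
  (Computable.cond hc hf hg).of_eq fun a => by by_cases h : c a <;> simp [h]

theorem computable_add {f g : α → ℕ} (hf : Computable f) (hg : Computable g) :
    Computable fun a => f a + g a :=
  (Primrec.nat_add.to_comp).comp hf hg

theorem computable_sub {f g : α → ℕ} (hf : Computable f) (hg : Computable g) :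
    Computable fun a => f a - g a :=
  (Primrec.nat_sub.to_comp).comp hf hg

theorem computable_mul {f g : α → ℕ} (hf : Computable f) (hg : Computable g) :
    Computable fun a => f a * g a :=
  (Primrec.nat_mul.to_comp).comp hf hg

theorem computable_div {f g : α → ℕ} (hf : Computable f) (hg : Computable g) :
    Computable fun a => f a / g a :=
  (Primrec.nat_div.to_comp).comp hf hg

theorem computable_two_pow {f : α → ℕ} (hf : Computable f) : Computable fun a => 2 ^ f a :=
  ((Primrec₂.unpaired'.1 Nat.Primrec.pow).to_comp).comp (Computable.const 2) hf

theorem computable_sum {f : α → ℕ → ℕ} {N : α → ℕ} (hf : Computable₂ f) (hN : Computable N) :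
    Computable fun a => ∑ i ∈ Finset.range (N a), f a i := by
  refine (Computable.nat_rec (h := fun a (p : ℕ × ℕ) => p.2 + f a p.1) hN (Computable.const 0)
    ?_).of_eq fun a => ?_
  · exact computable_add (Computable.snd.comp Computable.snd)
      (hf.comp Computable.fst (Computable.fst.comp Computable.snd))
  · induction N a with
    | zero => rfl
    | succ n ih => rw [Finset.sum_range_succ, ← ih]

end Computability

/-! ### Weights of requests -/

/-- The weight `2 ^ (-d)` of a request `(d, τ)` for a program of length `d` with output `τ`. -/
noncomputable def weight (o : Option (ℕ × List Bool)) : ℝ≥0∞ :=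
  o.elim 0 fun p => 2⁻¹ ^ p.1

/-- The weight of a request in units of `2 ^ (-T)`, rounded down. -/
def scaledWeight (T : ℕ) (o : Option (ℕ × List Bool)) : ℕ :=
  (o.map fun p => 2 ^ T / 2 ^ p.1).getD 0

theorem computable_scaledWeight {α : Type*} [Primcodable α] {T : α → ℕ}
    {o : α → Option (ℕ × List Bool)} (hT : Computable T) (ho : Computable o) :
    Computable fun a => scaledWeight (T a) (o a) :=
  Computable.option_getD (Computable.option_map ho (computable_div
    (computable_two_pow (hT.comp Computable.fst))
    (computable_two_pow (Computable.fst.comp Computable.snd))).to₂) (Computable.const 0)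

@[simp] theorem weight_none : weight none = 0 := rfl

@[simp] theorem weight_some (d : ℕ) (τ : List Bool) : weight (some (d, τ)) = 2⁻¹ ^ d := rfl

theorem weight_ne_top (o : Option (ℕ × List Bool)) : weight o ≠ ∞ := by
  rcases o with _ | ⟨d, τ⟩
  · simp
  · exact ENNReal.pow_ne_top (by simp)

theorem toReal_weight_some (d : ℕ) (τ : List Bool) :
    (weight (some (d, τ))).toReal = 1 / 2 ^ d := by
  simp

theorem two_pow_div_of_le {T d : ℕ} (h : d ≤ T) :
    ((2 ^ T / 2 ^ d : ℕ) : ℝ) = 2 ^ T * (1 / 2 ^ d) := by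
  rw [Nat.cast_div (pow_dvd_pow 2 h) (by positivity)]
  push_cast
  ring

theorem scaledWeight_eq {T : ℕ} {o : Option (ℕ × List Bool)} (h : ∀ p ∈ o, p.1 ≤ T) :
    (scaledWeight T o : ℝ) = 2 ^ T * (weight o).toReal := by
  rcases o with _ | ⟨d, τ⟩
  · simp [scaledWeight]
  · rw [toReal_weight_some, ← two_pow_div_of_le (h _ rfl)]
    rfl

/-! ### Binary values of strings -/

/-- The number with binary expansion `σ`, most significant bit first. -/
def binaryValue (σ : List Bool) : ℕ := σ.foldl (fun a b => 2 * a + b.toNat) 0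

theorem binaryValue_concat (σ : List Bool) (b : Bool) :
    binaryValue (σ ++ [b]) = 2 * binaryValue σ + b.toNat := by
  simp [binaryValue]

theorem binaryValue_lt (σ : List Bool) : binaryValue σ < 2 ^ σ.length := by
  induction σ using List.reverseRecOn with
  | nil => simp [binaryValue]
  | append_singleton σ b ih =>
    rw [binaryValue_concat, List.length_append, List.length_singleton, pow_succ]
    have := Bool.toNat_lt b
    omega

theorem binaryValue_append (σ ρ : List Bool) :
    binaryValue (σ ++ ρ) = binaryValue σ * 2 ^ ρ.length + binaryValue ρ := by
  induction ρ using List.reverseRecOn with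
  | nil => simp [binaryValue]
  | append_singleton ρ b ih =>
    rw [← List.append_assoc, binaryValue_concat, binaryValue_concat, ih, List.length_append,
      List.length_singleton, pow_succ]
    ring

theorem exists_binaryValue_eq (n p : ℕ) (h : p < 2 ^ n) :
    ∃ σ : List Bool, σ.length = n ∧ binaryValue σ = p := by
  induction n generalizing p with
  | zero => exact ⟨[], rfl, by simp at h; simp [h, binaryValue]⟩
  | succ n ih =>
    obtain ⟨σ, h1, h2⟩ := ih (p / 2) (by rw [pow_succ] at h; omega)
    refine ⟨σ ++ [decide (p % 2 = 1)], by simp [h1], ?_⟩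
    rw [binaryValue_concat, h2]
    rcases Nat.mod_two_eq_zero_or_one p with h | h <;> simp [h] <;> omega

theorem computable_binaryValue : Computable binaryValue := by
  refine (Primrec.list_foldl (h := fun _ (p : ℕ × Bool) => 2 * p.1 + p.2.toNat) Primrec.id
    (Primrec.const 0) ?_).to_comp
  exact Primrec.nat_add.comp
    (Primrec.nat_mul.comp (Primrec.const 2) (Primrec.fst.comp Primrec.snd))
    ((Primrec.dom_bool Bool.toNat).comp (Primrec.snd.comp Primrec.snd))

/-! ### The Kraft–Chaitin theorem -/

section KraftChaitin

variable (r : ℕ → Option (ℕ × List Bool))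

/-- An exponent such that the weights of the first `i` requests are multiples of `2 ^ (-D)`. -/
def denomExponent (i : ℕ) : ℕ := ∑ j ∈ Finset.range i, ((r j).map Prod.fst).getD 0

/-- The sum of the weights of the first `i` requests in units of `2 ^ (-denomExponent r i)`. -/
def scaledSum (i : ℕ) : ℕ := ∑ j ∈ Finset.range i, scaledWeight (denomExponent r i) (r j)

/-- The binary value of the code word of length `d + 1` that is assigned to request `i`. -/
def codeValue (i d : ℕ) : ℕ :=
  (scaledSum r i * 2 ^ (d + 1) + (2 ^ denomExponent r i - 1)) / 2 ^ denomExponent r i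

/-- The sum of the weights of the first `i` requests. -/
noncomputable def partialSum (i : ℕ) : ℝ := ∑ j ∈ Finset.range i, (weight (r j)).toReal

theorem scaledSum_eq (i : ℕ) : (scaledSum r i : ℝ) = partialSum r i * 2 ^ denomExponent r i := by
  rw [scaledSum, partialSum, Finset.sum_mul, Nat.cast_sum]
  refine Finset.sum_congr rfl fun j hj => ?_
  rw [scaledWeight_eq, mul_comm]
  intro p hp
  have h : ((r j).map Prod.fst).getD 0 ≤ denomExponent r i :=
    Finset.single_le_sum (f := fun j => ((r j).map Prod.fst).getD 0) (fun _ _ => Nat.zero_le _) hj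
  rw [Option.mem_def.1 hp] at h
  exact h

/-- Adding the denominator minus one before the division rounds up: `codeValue` is the ceiling of
`partialSum r i * 2 ^ (d + 1)`, in integer arithmetic. -/
theorem codeValue_bounds (i d : ℕ) :
    partialSum r i * 2 ^ (d + 1) ≤ codeValue r i d ∧
      (codeValue r i d : ℝ) < partialSum r i * 2 ^ (d + 1) + 1 := by
  set A := scaledSum r i
  set P := 2 ^ denomExponent r i with hP
  have hPpos : 0 < P := by positivity
  have hA : (A : ℝ) = partialSum r i * P := by
    rw [scaledSum_eq, hP]; push_cast; rfl
  have hPR : (0 : ℝ) < P := by exact_mod_cast hPpos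
  have h1 : codeValue r i d * P ≤ A * 2 ^ (d + 1) + (P - 1) := Nat.div_mul_le_self _ _
  have h2 : A * 2 ^ (d + 1) + (P - 1) < P * (codeValue r i d + 1) :=
    Nat.lt_mul_div_succ _ hPpos
  have h1' : codeValue r i d * P < A * 2 ^ (d + 1) + P := by omega
  have h2' : A * 2 ^ (d + 1) ≤ codeValue r i d * P := by
    rw [mul_add, mul_one, mul_comm P] at h2; omega
  have h1R : (codeValue r i d : ℝ) * P < A * 2 ^ (d + 1) + P := by exact_mod_cast h1'
  have h2R : (A : ℝ) * 2 ^ (d + 1) ≤ codeValue r i d * P := by exact_mod_cast h2'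
  rw [hA] at h1R h2R
  constructor
  · nlinarith
  · nlinarith

variable {r}

theorem computable_denomExponent (hr : Computable r) : Computable (denomExponent r) :=
  computable_sum (Computable.option_getD (Computable.option_map (hr.comp Computable.snd)
    (Computable.fst.comp Computable.snd).to₂) (Computable.const 0)).to₂ Computable.id

theorem computable_codeValue (hr : Computable r) : Computable₂ (codeValue r) := by
  have hD := computable_denomExponent hr
  have hA : Computable (scaledSum r) := computable_sum
    (computable_scaledWeight (hD.comp Computable.fst) (hr.comp Computable.snd)).to₂ Computable.id
  have hP : Computable fun p : ℕ × ℕ => 2 ^ denomExponent r p.1 :=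
    computable_two_pow (hD.comp Computable.fst)
  exact computable_div (computable_add (computable_mul (hA.comp Computable.fst)
    (computable_two_pow (computable_add Computable.snd (Computable.const 1))))
    (computable_sub hP (Computable.const 1))) hP

theorem partialSum_mono : Monotone (partialSum r) := by
  refine monotone_nat_of_le_succ fun i => ?_
  rw [partialSum, partialSum, Finset.sum_range_succ]
  exact le_add_of_nonneg_right ENNReal.toReal_nonneg

theorem partialSum_le_one (h : ∑' i, weight (r i) ≤ 1) (i : ℕ) : partialSum r i ≤ 1 := by
  rw [partialSum, ← ENNReal.toReal_sum fun _ _ => weight_ne_top _]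
  exact ENNReal.toReal_mono ENNReal.one_ne_top ((ENNReal.sum_le_tsum _).trans h) |>.trans (by simp)

theorem partialSum_succ {i d : ℕ} {τ : List Bool} (h : r i = some (d, τ)) :
    partialSum r (i + 1) = partialSum r i + 1 / 2 ^ d := by
  rw [partialSum, Finset.sum_range_succ, h, toReal_weight_some, partialSum]

/-- Request `i` owns the interval between consecutive partial sums, of length `2 ^ (-d)`. It
contains an aligned dyadic interval of half that length. This is why code words have length `d + 1`,
and it makes any reordering of the requests unnecessary. -/
theorem codeValue_interval {i d : ℕ} {τ : List Bool} (h : r i = some (d, τ)) :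
    partialSum r i ≤ codeValue r i d / 2 ^ (d + 1) ∧
      ((codeValue r i d : ℝ) + 1) / 2 ^ (d + 1) ≤ partialSum r (i + 1) := by
  obtain ⟨h1, h2⟩ := codeValue_bounds r i d
  rw [partialSum_succ h]
  have hp : (0 : ℝ) < 2 ^ d := by positivity
  constructor
  · rw [le_div_iff₀ (by positivity)]; exact h1
  · rw [div_le_iff₀ (by positivity)]
    have : (partialSum r i + 1 / 2 ^ d) * 2 ^ (d + 1) = partialSum r i * 2 ^ (d + 1) + 2 := by
      rw [pow_succ]; field_simp
    rw [this]; linarith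

/-- Code words of different requests are incomparable. -/
theorem codeWord_index_eq {i i' d d' : ℕ} {τ τ' σ σ' : List Bool} (h : r i = some (d, τ))
    (h' : r i' = some (d', τ')) (hl : σ.length = d + 1) (hl' : σ'.length = d' + 1)
    (hv : binaryValue σ = codeValue r i d) (hv' : binaryValue σ' = codeValue r i' d')
    (hp : σ <+: σ') : i = i' := by
  obtain ⟨ρ, rfl⟩ := hp
  obtain ⟨a1, a2⟩ := codeValue_interval h
  obtain ⟨b1, b2⟩ := codeValue_interval h'
  rw [← hv, ← hl] at a1 a2
  rw [← hv', ← hl', binaryValue_append, List.length_append, pow_add] at b1 b2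
  have hρ : ((binaryValue ρ : ℝ) + 1) ≤ 2 ^ ρ.length := by exact_mod_cast binaryValue_lt ρ
  have hσ : (0 : ℝ) < 2 ^ σ.length := by positivity
  have hρ' : (0 : ℝ) < 2 ^ ρ.length := by positivity
  have hρ0 : (0 : ℝ) ≤ binaryValue ρ := Nat.cast_nonneg _
  -- The dyadic interval of an extension lies inside that of its prefix (`e1`, `e2`) and is nonempty
  -- (`e3`), whereas different requests own disjoint intervals.
  have e1 : (binaryValue σ : ℝ) / 2 ^ σ.length ≤
      ((binaryValue σ * 2 ^ ρ.length + binaryValue ρ : ℕ) : ℝ) /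
        (2 ^ σ.length * 2 ^ ρ.length) := by
    rw [div_le_div_iff₀ hσ (by positivity)]
    push_cast
    nlinarith [mul_nonneg hρ0 hσ.le]
  have e2 : (((binaryValue σ * 2 ^ ρ.length + binaryValue ρ : ℕ) : ℝ) + 1) /
        (2 ^ σ.length * 2 ^ ρ.length) ≤ ((binaryValue σ : ℝ) + 1) / 2 ^ σ.length := by
    rw [div_le_div_iff₀ (by positivity) hσ]
    push_cast
    nlinarith [mul_le_mul_of_nonneg_left hρ hσ.le]
  have e3 : ((binaryValue σ * 2 ^ ρ.length + binaryValue ρ : ℕ) : ℝ) /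
        (2 ^ σ.length * 2 ^ ρ.length) <
      (((binaryValue σ * 2 ^ ρ.length + binaryValue ρ : ℕ) : ℝ) + 1) /
        (2 ^ σ.length * 2 ^ ρ.length) := by
    gcongr
    linarith
  rcases lt_trichotomy i i' with hlt | heq | hlt
  · have := partialSum_mono (r := r) (Nat.succ_le_of_lt hlt)
    simp only [Nat.succ_eq_add_one] at this
    linarith
  · exact heq
  · have := partialSum_mono (r := r) (Nat.succ_le_of_lt hlt)
    simp only [Nat.succ_eq_add_one] at this
    linarith

/-- Kraft–Chaitin: a computable sequence of requests of total weight at most one is served by a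
prefix-free partial computable function. -/
theorem kraftChaitin (hr : Computable r) (hs : ∑' i, weight (r i) ≤ 1) :
    ∃ f : List Bool →. List Bool, Partrec f ∧
      (∀ σ ρ : List Bool, (f σ).Dom → (f ρ).Dom → σ <+: ρ → σ = ρ) ∧
      ∀ i d τ, r i = some (d, τ) → ∃ σ : List Bool, σ.length = d + 1 ∧ τ ∈ f σ := by
  let g : List Bool → ℕ → Option (List Bool) := fun σ i => (r i).bind fun p =>
    if σ.length = p.1 + 1 ∧ binaryValue σ = codeValue r i p.1 then some p.2 else none
  have hg : Computable₂ g := by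
    refine Computable.option_bind (hr.comp Computable.snd) ?_
    refine computable_ite (computable_decide_and (computable_decide_eq ?_ ?_)
      (computable_decide_eq ?_ ?_)) ?_ (Computable.const none)
    · exact Computable.list_length.comp (Computable.fst.comp Computable.fst)
    · exact computable_add (Computable.fst.comp Computable.snd) (Computable.const 1)
    · exact computable_binaryValue.comp (Computable.fst.comp Computable.fst)
    · exact (computable_codeValue hr).comp (Computable.snd.comp Computable.fst)
        (Computable.fst.comp Computable.snd)
    · exact Computable.option_some.comp (Computable.snd.comp Computable.snd)
  have hg' : ∀ {σ i τ}, τ ∈ g σ i → ∃ d, r i = some (d, τ) ∧ σ.length = d + 1 ∧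
      binaryValue σ = codeValue r i d := by
    intro σ i τ h
    obtain ⟨⟨d, τ'⟩, hd, h⟩ := Option.bind_eq_some_iff.1 h
    dsimp only at h
    split_ifs at h with hc
    obtain rfl : τ' = τ := Option.some.inj h
    exact ⟨d, hd, hc.1, hc.2⟩
  refine ⟨fun σ => Nat.rfindOpt (g σ), Partrec.rfindOpt hg, ?_, ?_⟩
  · intro σ ρ hσ hρ hp
    obtain ⟨i, τ, h⟩ := Nat.rfindOpt_dom.1 hσ
    obtain ⟨i', τ', h'⟩ := Nat.rfindOpt_dom.1 hρ
    obtain ⟨d, hd, hl, hv⟩ := hg' h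
    obtain ⟨d', hd', hl', hv'⟩ := hg' h'
    obtain rfl := codeWord_index_eq hd hd' hl hl' hv hv' hp
    rw [hd] at hd'
    obtain ⟨rfl, rfl⟩ := Prod.mk.inj (Option.some.inj hd')
    exact hp.eq_of_length (hl.trans hl'.symm)
  · intro i d τ h
    have hlt : codeValue r i d < 2 ^ (d + 1) := by
      have h1 := (codeValue_interval h).2.trans (partialSum_le_one hs _)
      rw [div_le_one (by positivity)] at h1
      have : codeValue r i d + 1 ≤ 2 ^ (d + 1) := by exact_mod_cast h1
      omega
    obtain ⟨σ, hl, hv⟩ := exists_binaryValue_eq _ _ hlt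
    refine ⟨σ, hl, ?_⟩
    have hmem : τ ∈ g σ i := by simp [g, h, hl, hv]
    have hdom : (Nat.rfindOpt (g σ)).Dom := Nat.rfindOpt_dom.2 ⟨i, τ, hmem⟩
    -- The search might stop at another request with the same code word; `codeWord_index_eq`
    -- excludes this.
    obtain ⟨i', h'⟩ := Nat.rfindOpt_spec (Part.get_mem hdom)
    obtain ⟨d', hd', hl', hv'⟩ := hg' h'
    obtain rfl := codeWord_index_eq h hd' hl hl' hv hv' List.prefix_rfl
    rw [h] at hd'
    have : τ = (Nat.rfindOpt (g σ)).get hdom := (Prod.mk.inj (Option.some.inj hd')).2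
    rw [this]
    exact Part.get_mem hdom

end KraftChaitin

/-! ### Cylinders -/

instance : IsProbabilityMeasure lebesgue := by
  unfold lebesgue
  infer_instance

@[simp] theorem length_restrict (X : Cantor) (n : ℕ) : (restrict X n).length = n := by
  simp [restrict]

/-- The sequences that extend the string `ρ`. -/
def cylinder (ρ : List Bool) : Set Cantor := {X | restrict X ρ.length = ρ}

theorem restrict_eq_of_mem_cylinder {X : Cantor} {ρ : List Bool} (h : X ∈ cylinder ρ) :
    restrict X ρ.length = ρ := h

theorem cylinder_eq_pi (ρ : List Bool) :
    cylinder ρ = Set.pi (Finset.range ρ.length) fun i => {ρ.getD i false} := by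
  ext X
  simp only [cylinder, restrict, Set.mem_ofPred_eq, Set.mem_pi, Finset.coe_range, Set.mem_Iio,
    Set.mem_singleton_iff]
  rw [List.ext_getElem_iff]
  constructor
  · rintro ⟨_, h⟩ i hi
    have := h i (by simpa using hi) hi
    simpa [hi] using this
  · intro h
    refine ⟨by simp, fun i h1 h2 => ?_⟩
    simpa [h2] using h i h2

theorem measurableSet_cylinder (ρ : List Bool) : MeasurableSet (cylinder ρ) := by
  rw [cylinder_eq_pi]
  exact MeasurableSet.pi (Finset.countable_toSet _) fun _ _ => measurableSet_singleton _

theorem lebesgue_cylinder (ρ : List Bool) : lebesgue (cylinder ρ) = 2⁻¹ ^ ρ.length := by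
  rw [cylinder_eq_pi, lebesgue, Measure.infinitePi_pi _ fun _ _ => measurableSet_singleton _]
  simp

theorem restrict_take (X : Cantor) {n m : ℕ} (h : n ≤ m) :
    (restrict X m).take n = restrict X n := by
  simp [restrict, ← List.map_take, List.take_range, h]

theorem restrict_prefix (X : Cantor) {n m : ℕ} (h : n ≤ m) : restrict X n <+: restrict X m :=
  restrict_take X h ▸ List.take_prefix _ _

theorem eq_restrict_of_prefix {X : Cantor} {ρ : List Bool} {m : ℕ} (h : ρ <+: restrict X m) :
    ρ = restrict X ρ.length := by
  have hl : ρ.length ≤ m := by simpa using h.length_le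
  rw [← restrict_take X hl]
  exact List.prefix_iff_eq_take.1 h

theorem disjoint_cylinder {ρ σ : List Bool} (h : ¬ ρ <+: σ) (h' : ¬ σ <+: ρ) :
    Disjoint (cylinder ρ) (cylinder σ) := by
  rw [Set.disjoint_left]
  intro X hρ hσ
  rw [← restrict_eq_of_mem_cylinder hρ, ← restrict_eq_of_mem_cylinder hσ] at h h'
  rcases le_total ρ.length σ.length with hl | hl
  · exact h (restrict_prefix X hl)
  · exact h' (restrict_prefix X hl)

/-! ### Halting computations as a sequence of requests -/

/-- What the core argument uses of a universal prefix-free machine: its halting computations are a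
computable sequence of requests of total weight at most one that is as good as any other up to a
constant. -/
structure UniversalRequests (e : ℕ → Option (ℕ × List Bool)) : Prop where
  computable : Computable e
  tsum_le : ∑' i, weight (e i) ≤ 1
  exists_const : ∀ r : ℕ → Option (ℕ × List Bool), Computable r → ∑' i, weight (r i) ≤ 1 →
    ∃ c, ∀ i d τ, r i = some (d, τ) → ∃ j d', e j = some (d', τ) ∧ d' ≤ d + c

/-- An index codes a program together with its halting step, and a pair is at least its second
component. So a bound on the index bounds the running time, which is how computable bounds on
indices become time bounds. -/
theorem Machine.exists_universalRequests (U : Machine) (hU : U.IsUniversal) :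
    ∃ e : ℕ → Option (ℕ × List Bool), UniversalRequests e ∧
      (∀ i d τ, e i = some (d, τ) → ∀ t : ℕ → ℕ, i ≤ t τ.length → U.timeComplexity t τ ≤ d) ∧
      ∀ (τ : List Bool) (B : ℕ∞), (∀ i d, e i = some (d, τ) → B ≤ d) → B ≤ U.complexity τ := by
  obtain ⟨O, hO, hout, huniq⟩ := U.exists_primrec_output
  obtain ⟨hpf, huniv⟩ := hU
  let e : ℕ → Option (ℕ × List Bool) := fun i =>
    (Encodable.decode (α := List Bool) i.unpair.1).bind fun ρ =>
      -- Several numbers might decode to the same program; only its canonical code is admitted.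
      if Encodable.encode ρ = i.unpair.1 then (O ρ i.unpair.2).map fun τ => (ρ.length, τ) else none
  have he : ∀ {i d τ}, e i = some (d, τ) ↔ ∃ ρ s, i = Nat.pair (Encodable.encode ρ) s ∧
      ρ.length = d ∧ O ρ s = some τ := by
    intro i d τ
    constructor
    · intro h
      obtain ⟨ρ, hρ, h⟩ := Option.bind_eq_some_iff.1 h
      split_ifs at h with hc
      obtain ⟨τ', hτ', h⟩ := Option.map_eq_some_iff.1 h
      obtain ⟨h1, rfl⟩ := Prod.mk.inj h
      exact ⟨ρ, i.unpair.2, by rw [hc, Nat.pair_unpair], h1, hτ'⟩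
    · rintro ⟨ρ, s, rfl, rfl, h⟩
      simp [e, h]
  have hcomp : Computable e := by
    refine Computable.option_bind
      (Computable.decode.comp (Computable.fst.comp Computable.unpair)) ?_
    have h1 : Computable fun p : ℕ × List Bool => p.1.unpair := Computable.unpair.comp Computable.fst
    refine computable_ite (computable_decide_eq (Computable.encode.comp Computable.snd)
      (Computable.fst.comp h1)) ?_ (Computable.const none)
    refine Computable.option_map (hO.to_comp.comp Computable.snd (Computable.snd.comp h1)) ?_
    exact ((Computable.list_length.comp (Computable.snd.comp Computable.fst)).pair
      Computable.snd).to₂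
  refine ⟨e, ⟨hcomp, ?_, ?_⟩, ?_, ?_⟩
  · let A : ℕ → Set Cantor := fun i => {X | ∃ ρ s τ, i = Nat.pair (Encodable.encode ρ) s ∧
      O ρ s = some τ ∧ X ∈ cylinder ρ}
    have hA : ∀ {ρ s τ}, O ρ s = some τ → A (Nat.pair (Encodable.encode ρ) s) = cylinder ρ := by
      intro ρ s τ h
      ext X
      constructor
      · rintro ⟨ρ', s', τ', hp, _, hX⟩
        obtain ⟨h1, _⟩ := Nat.pair_eq_pair.1 hp
        rwa [Encodable.encode_injective h1]
      · intro hX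
        exact ⟨ρ, s, τ, rfl, h, hX⟩
    have hA0 : ∀ {i}, e i = none → A i = ∅ := by
      intro i h
      by_contra hne
      obtain ⟨X, ρ, s, τ, hi, hO, _⟩ := Set.nonempty_iff_ne_empty.2 hne
      rw [he.2 ⟨ρ, s, hi, rfl, hO⟩] at h
      cases h
    have hw : ∀ i, weight (e i) = lebesgue (A i) := by
      intro i
      rcases h : e i with _ | ⟨d, τ⟩
      · simp [hA0 h]
      · obtain ⟨ρ, s, rfl, rfl, hO⟩ := he.1 h
        rw [hA hO, lebesgue_cylinder, weight_some]
    have hm : ∀ i, MeasurableSet (A i) := by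
      intro i
      rcases h : e i with _ | ⟨d, τ⟩
      · simp [hA0 h]
      · obtain ⟨ρ, s, rfl, rfl, hO⟩ := he.1 h
        rw [hA hO]
        exact measurableSet_cylinder ρ
    -- Different programs have disjoint cylinders by prefix-freeness, and a single program halts at
    -- only one step.
    have hd : Pairwise (Function.onFun Disjoint A) := by
      intro i j hij
      rw [Function.onFun, Set.disjoint_left]
      rintro X ⟨ρ, s, τ, rfl, h, hX⟩ ⟨ρ', s', τ', rfl, h', hX'⟩
      have key : ρ = ρ' := by
        have o1 : U.Outputs ρ τ := ⟨s, (hout _ _ _).2 ⟨s, le_rfl, h⟩⟩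
        have o2 : U.Outputs ρ' τ' := ⟨s', (hout _ _ _).2 ⟨s', le_rfl, h'⟩⟩
        by_contra hne
        refine Set.disjoint_left.1 (disjoint_cylinder (fun hp => hne ?_) fun hp => hne ?_) hX hX'
        · exact hpf _ _ _ _ o1 o2 hp
        · exact (hpf _ _ _ _ o2 o1 hp).symm
      subst key
      exact hij (by rw [huniq ρ s s' (by simp [h]) (by simp [h'])])
    simp_rw [hw]
    rw [← measure_iUnion hd hm]
    exact prob_le_one
  · intro r hr hs
    obtain ⟨f, hf, hfpf, hserve⟩ := kraftChaitin hr hs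
    obtain ⟨c, hc⟩ := huniv f hf hfpf
    -- The extra one is the additional bit of the Kraft–Chaitin code words.
    refine ⟨c + 1, fun i d τ h => ?_⟩
    obtain ⟨σ, hl, hmem⟩ := hserve i d τ h
    obtain ⟨σ', ⟨S, hS⟩, hl'⟩ := hc σ τ hmem
    obtain ⟨s, _, hs⟩ := (hout _ _ _).1 hS
    exact ⟨_, _, he.2 ⟨σ', s, rfl, rfl, hs⟩, by omega⟩
  · intro i d τ h t hi
    obtain ⟨ρ, s, rfl, rfl, hO⟩ := he.1 h
    exact iInf₂_le ρ ((hout _ _ _).2 ⟨s, (Nat.right_le_pair _ _).trans hi, hO⟩)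
  · intro τ B h
    refine le_iInf₂ fun ρ hρ => ?_
    obtain ⟨S, hS⟩ := hρ
    obtain ⟨s, _, hs⟩ := (hout _ _ _).1 hS
    exact h _ _ (he.2 ⟨ρ, s, rfl, rfl, hs⟩)

/-! ### Indices at which the mass of a length is computably bounded -/

theorem tsum_unpair (f : ℕ → ℕ → ℝ≥0∞) :
    ∑' i : ℕ, f i.unpair.1 i.unpair.2 = ∑' a, ∑' b, f a b := by
  rw [← ENNReal.tsum_prod, ← Nat.pairEquiv.symm.tsum_eq]
  rfl

theorem tsum_le_of_support_subsingleton {ι : Type*} {f : ι → ℝ≥0∞} {x : ℝ≥0∞} (h : ∀ i, f i ≤ x)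
    (hs : ∀ i j, f i ≠ 0 → f j ≠ 0 → i = j) : ∑' i, f i ≤ x := by
  by_cases h0 : ∃ i, f i ≠ 0
  · obtain ⟨i, hi⟩ := h0
    rw [tsum_eq_single i fun j hj => by_contra fun hne => hj (hs j i hne hi)]
    exact h i
  · push Not at h0
    simp [h0]

theorem two_pow_mul_half_pow (k m : ℕ) : (2 : ℝ≥0∞) ^ k * 2⁻¹ ^ (k + m) = 2⁻¹ ^ m := by
  rw [pow_add, ← mul_assoc, ← mul_pow, ENNReal.mul_inv_cancel (by simp) (by simp), one_pow, one_mul]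

theorem two_pow_mul_half_pow_self (k : ℕ) : (2 : ℝ≥0∞) ^ k * 2⁻¹ ^ k = 1 := by
  simpa using two_pow_mul_half_pow k 0

/-- Keep a request if its output has length `n`. -/
def ofLength (n : ℕ) (o : Option (ℕ × List Bool)) : Option (ℕ × List Bool) :=
  o.bind fun p => if p.2.length = n then some p else none

theorem ofLength_some (n d : ℕ) (τ : List Bool) :
    ofLength n (some (d, τ)) = if τ.length = n then some (d, τ) else none := rfl

theorem ofLength_eq_some {n d : ℕ} {τ : List Bool} {o : Option (ℕ × List Bool)}
    (h : ofLength n o = some (d, τ)) : o = some (d, τ) ∧ τ.length = n := by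
  rcases o with _ | ⟨d', τ'⟩
  · cases h
  · rw [ofLength_some] at h
    split_ifs at h with hl
    cases h
    exact ⟨rfl, hl⟩

theorem computable_ofLength {α : Type*} [Primcodable α] {n : α → ℕ}
    {o : α → Option (ℕ × List Bool)} (hn : Computable n) (ho : Computable o) :
    Computable fun a => ofLength (n a) (o a) :=
  Computable.option_bind ho (computable_ite
    (computable_decide_eq (Computable.list_length.comp (Computable.snd.comp Computable.snd))
      (hn.comp Computable.fst))
    (Computable.option_some.comp Computable.snd) (Computable.const none)).to₂

/-- The total weight of the requests for strings of length `n`. -/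
noncomputable def lengthMass (e : ℕ → Option (ℕ × List Bool)) (n : ℕ) : ℝ≥0∞ :=
  ∑' j, weight (ofLength n (e j))

theorem tsum_weight_ofLength (o : Option (ℕ × List Bool)) :
    ∑' n, weight (ofLength n o) = weight o := by
  rcases o with _ | ⟨d, τ⟩
  · simp [ofLength]
  · rw [tsum_eq_single τ.length]
    · rw [ofLength_some, if_pos rfl]
    · intro n hn
      rw [ofLength_some, if_neg hn.symm, weight_none]

theorem tsum_lengthMass (e : ℕ → Option (ℕ × List Bool)) :
    ∑' n, lengthMass e n = ∑' j, weight (e j) := by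
  simp_rw [lengthMass]
  rw [ENNReal.tsum_comm]
  simp_rw [tsum_weight_ofLength]

/-- The approximation at stage `T` of `lengthMass e n`, in units of `2 ^ (-T)`. -/
def stageMass (e : ℕ → Option (ℕ × List Bool)) (n T : ℕ) : ℕ :=
  ∑ j ∈ Finset.range T, scaledWeight T (ofLength n (e j))

theorem scaledWeight_le (T : ℕ) (o : Option (ℕ × List Bool)) :
    (scaledWeight T o : ℝ≥0∞) ≤ 2 ^ T * weight o := by
  rcases o with _ | ⟨d, τ⟩
  · simp [scaledWeight]
  · have h : 2 ^ T / 2 ^ d * 2 ^ d ≤ 2 ^ T := Nat.div_mul_le_self _ _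
    have h' : ((2 ^ T / 2 ^ d : ℕ) : ℝ≥0∞) * 2 ^ d ≤ 2 ^ T := by exact_mod_cast h
    calc ((scaledWeight T (some (d, τ)) : ℕ) : ℝ≥0∞)
        = ((2 ^ T / 2 ^ d : ℕ) : ℝ≥0∞) * (2 ^ d * 2⁻¹ ^ d) := by
          rw [two_pow_mul_half_pow_self, mul_one]; rfl
      _ ≤ 2 ^ T * weight (some (d, τ)) := by
          rw [← mul_assoc, weight_some]; gcongr

theorem le_scaledWeight {T : ℕ} {o : Option (ℕ × List Bool)} (h : ∀ p ∈ o, p.1 ≤ T) :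
    2 ^ T * weight o ≤ (scaledWeight T o : ℝ≥0∞) := by
  rcases o with _ | ⟨d, τ⟩
  · simp
  · obtain ⟨k, rfl⟩ := Nat.exists_eq_add_of_le (h _ rfl)
    have h' : scaledWeight (d + k) (some (d, τ)) = 2 ^ k := by
      change 2 ^ (d + k) / 2 ^ d = 2 ^ k
      rw [pow_add, Nat.mul_div_cancel_left _ (by positivity)]
    rw [h', weight_some, pow_add, mul_right_comm, two_pow_mul_half_pow_self]
    simp

theorem scaledWeight_succ (T : ℕ) (o : Option (ℕ × List Bool)) :
    2 * scaledWeight T o ≤ scaledWeight (T + 1) o := by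
  rcases o with _ | ⟨d, τ⟩
  · simp [scaledWeight]
  · change 2 * (2 ^ T / 2 ^ d) ≤ 2 ^ (T + 1) / 2 ^ d
    rw [Nat.le_div_iff_mul_le (by positivity), mul_assoc, pow_succ, mul_comm]
    exact Nat.mul_le_mul_right 2 (Nat.div_mul_le_self _ _)

theorem stageMass_le (e : ℕ → Option (ℕ × List Bool)) (n T : ℕ) :
    (stageMass e n T : ℝ≥0∞) ≤ 2 ^ T * lengthMass e n := by
  rw [stageMass, Nat.cast_sum]
  calc _ ≤ ∑ j ∈ Finset.range T, 2 ^ T * weight (ofLength n (e j)) :=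
        Finset.sum_le_sum fun j _ => scaledWeight_le _ _
    _ ≤ 2 ^ T * lengthMass e n := by
        rw [← Finset.mul_sum]
        gcongr
        exact ENNReal.sum_le_tsum _

/-- Halving the unit at least doubles the count, since rounding down only gets finer. This makes
`Exceeds` monotone in the stage. -/
theorem stageMass_succ (e : ℕ → Option (ℕ × List Bool)) (n T : ℕ) :
    2 * stageMass e n T ≤ stageMass e n (T + 1) := by
  rw [stageMass, stageMass, Finset.mul_sum, Finset.sum_range_succ]
  exact le_add_right (Finset.sum_le_sum fun j _ => scaledWeight_succ _ _)

theorem exists_lt_stageMass {e : ℕ → Option (ℕ × List Bool)} {n : ℕ} {x : ℝ≥0∞}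
    (h : x < lengthMass e n) : ∃ T, 2 ^ T * x < stageMass e n T := by
  rw [lengthMass, ENNReal.tsum_eq_iSup_nat] at h
  obtain ⟨N, hN⟩ := lt_iSup_iff.1 h
  let D := ∑ j ∈ Finset.range N, ((e j).map Prod.fst).getD 0
  -- The stage includes the first `N` requests and is at least as large as each of their lengths, so
  -- none of their weights is rounded.
  refine ⟨N + D, ?_⟩
  have h2 : (2 : ℝ≥0∞) ^ (N + D) * x <
      2 ^ (N + D) * ∑ j ∈ Finset.range N, weight (ofLength n (e j)) := by
    rw [ENNReal.mul_lt_mul_iff_right (by simp) (by simp)]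
    exact hN
  refine h2.trans_le ?_
  rw [stageMass, Nat.cast_sum, Finset.mul_sum]
  calc _ ≤ ∑ j ∈ Finset.range N, (scaledWeight (N + D) (ofLength n (e j)) : ℝ≥0∞) := by
        refine Finset.sum_le_sum fun j hj => le_scaledWeight ?_
        rintro ⟨d, τ⟩ hp
        have hle : ((e j).map Prod.fst).getD 0 ≤ D :=
          Finset.single_le_sum (f := fun j => ((e j).map Prod.fst).getD 0)
            (fun _ _ => Nat.zero_le _) hj
        rw [(ofLength_eq_some (Option.mem_def.1 hp)).1] at hle
        exact le_add_left hle
    _ ≤ _ := Finset.sum_le_sum_of_subset (Finset.range_mono (Nat.le_add_right _ _))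

/-- At stage `T`, the mass of the length `n` is seen to exceed `2 ^ (2 * c)` times the weight of the
request with index `n`. -/
@[irreducible] def Exceeds (e : ℕ → Option (ℕ × List Bool)) (c n T : ℕ) : Prop :=
  2 ^ (2 * c + T) < ((e n).map fun p => 2 ^ p.1).getD 0 * stageMass e n T

noncomputable instance (e : ℕ → Option (ℕ × List Bool)) (c n T : ℕ) :
    Decidable (Exceeds e c n T) :=
  Classical.propDecidable _

theorem Exceeds.succ {e : ℕ → Option (ℕ × List Bool)} {c n T : ℕ} (h : Exceeds e c n T) :
    Exceeds e c n (T + 1) := by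
  unfold Exceeds at h ⊢
  calc 2 ^ (2 * c + (T + 1)) = 2 * 2 ^ (2 * c + T) := by ring
    _ < 2 * (((e n).map fun p => 2 ^ p.1).getD 0 * stageMass e n T) := by omega
    _ = ((e n).map fun p => 2 ^ p.1).getD 0 * (2 * stageMass e n T) := by ring
    _ ≤ _ := Nat.mul_le_mul_left _ (stageMass_succ e n T)

theorem Exceeds.mono {e : ℕ → Option (ℕ × List Bool)} {c n T T' : ℕ} (h : Exceeds e c n T)
    (hT : T ≤ T') : Exceeds e c n T' := by
  induction hT with
  | refl => exact h
  | step _ ih => exact ih.succ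

theorem Exceeds.le {e : ℕ → Option (ℕ × List Bool)} {c n T d : ℕ} {τ : List Bool}
    (h : Exceeds e c n T) (hn : e n = some (d, τ)) : 2 ^ (2 * c) ≤ 2 ^ d * lengthMass e n := by
  unfold Exceeds at h
  rw [hn] at h
  have h' : (2 : ℝ≥0∞) ^ (2 * c + T) ≤ 2 ^ d * stageMass e n T := by exact_mod_cast h.le
  have h2 := h'.trans (mul_le_mul_right (stageMass_le e n T) _)
  rw [pow_add, mul_comm, mul_left_comm] at h2
  rwa [ENNReal.mul_le_mul_iff_right (by simp) (by simp)] at h2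

/-- For the triple `i` of `c`, `n`, `T`: request the output of the request with index `n` by a
program that is shorter by `c - 1`, if `Exceeds e c n` starts to hold at stage `T + 1`. -/
noncomputable def shorterRequests (e : ℕ → Option (ℕ × List Bool)) (c n T : ℕ) : Option (ℕ × List Bool) :=
  if Exceeds e c n (T + 1) ∧ ¬ Exceeds e c n T then (e n).map fun p => (p.1 - c + 1, p.2) else none

theorem UniversalRequests.exists_program {e : ℕ → Option (ℕ × List Bool)}
    (he : UniversalRequests e) (τ : List Bool) : ∃ j d, e j = some (d, τ) := by
  obtain ⟨c, hc⟩ := he.exists_const (fun i => if i = 0 then some (0, τ) else none)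
    (computable_ite (computable_decide_eq Computable.id (Computable.const 0))
      (Computable.const _) (Computable.const _)) (by
        rw [tsum_eq_single 0 (fun i hi => by simp [hi])]; simp)
  obtain ⟨j, d, h, _⟩ := hc 0 0 τ rfl
  exact ⟨j, d, h⟩

theorem lengthMass_le_one {e : ℕ → Option (ℕ × List Bool)} (he : ∑' i, weight (e i) ≤ 1) (n : ℕ) :
    lengthMass e n ≤ 1 :=
  (ENNReal.le_tsum n).trans ((tsum_lengthMass e).trans_le he)

theorem Exceeds.two_mul_le {e : ℕ → Option (ℕ × List Bool)} (he : ∑' i, weight (e i) ≤ 1)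
    {c n T d : ℕ} {τ : List Bool} (h : Exceeds e c n T) (hn : e n = some (d, τ)) : 2 * c ≤ d := by
  have h1 : (2 : ℝ≥0∞) ^ (2 * c) ≤ 2 ^ d :=
    (h.le hn).trans (mul_le_of_le_one_right' (lengthMass_le_one he n))
  have h2 : (2 : ℕ) ^ (2 * c) ≤ 2 ^ d := by exact_mod_cast h1
  exact (Nat.pow_le_pow_iff_right (by norm_num)).1 h2

/-- When `Exceeds` holds, `2 ^ (-d)` is at most `2 ^ (-2c)` times the mass. Saving `c - 1` bits
multiplies the weight by `2 ^ (c - 1)`, which leaves the factor `2 ^ (-(c + 1))`, summable over `c`.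
Since `2 * c ≤ d`, the truncated subtraction is exact. -/
theorem weight_shorterRequests_le {e : ℕ → Option (ℕ × List Bool)} (he : ∑' i, weight (e i) ≤ 1)
    (c n T : ℕ) : weight (shorterRequests e c n T) ≤ 2⁻¹ ^ (c + 1) * lengthMass e n := by
  unfold shorterRequests
  split_ifs with h
  · rcases hn : e n with _ | ⟨d, τ⟩
    · simp
    · have hd := h.1.two_mul_le he hn
      obtain ⟨k, rfl⟩ := Nat.exists_eq_add_of_le hd
      have e1 : 2 * c + k - c + 1 = c + k + 1 := by omega
      simp only [Option.map_some, weight_some, e1]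
      calc (2⁻¹ : ℝ≥0∞) ^ (c + k + 1)
          = 2 ^ (2 * c) * 2⁻¹ ^ (2 * c + (c + k + 1)) := (two_pow_mul_half_pow _ _).symm
        _ ≤ 2 ^ (2 * c + k) * lengthMass e n * 2⁻¹ ^ (2 * c + (c + k + 1)) := by
            gcongr
            exact h.1.le hn
        _ = 2 ^ (2 * c + k) * 2⁻¹ ^ (2 * c + k + (c + 1)) * lengthMass e n := by
            rw [mul_right_comm]
            congr 3
            ring
        _ = _ := by rw [two_pow_mul_half_pow]
  · simp

theorem tsum_half_pow_succ : ∑' c : ℕ, (2⁻¹ : ℝ≥0∞) ^ (c + 1) = 1 := by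
  simp_rw [pow_succ]
  rw [ENNReal.tsum_mul_right, ENNReal.tsum_geometric, ENNReal.one_sub_inv_two, inv_inv,
    ENNReal.mul_inv_cancel (by simp) (by simp)]

theorem tsum_shorterRequests_le {e : ℕ → Option (ℕ × List Bool)} (he : ∑' i, weight (e i) ≤ 1) :
    ∑' c, ∑' n, ∑' T, weight (shorterRequests e c n T) ≤ 1 := by
  -- Since `Exceeds` persists, it starts to hold at one stage at most.
  have huniq : ∀ c n T T', weight (shorterRequests e c n T) ≠ 0 →
      weight (shorterRequests e c n T') ≠ 0 → ¬ T < T' := by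
    intro c n T T' h h' hlt
    unfold shorterRequests at h h'
    split_ifs at h h' with h1 h2
    · exact h2.2 (h1.1.mono hlt)
    all_goals simp at h h'
  calc ∑' c, ∑' n, ∑' T, weight (shorterRequests e c n T)
      ≤ ∑' c, ∑' n, 2⁻¹ ^ (c + 1) * lengthMass e n := by
        refine ENNReal.tsum_le_tsum fun c => ENNReal.tsum_le_tsum fun n => ?_
        refine tsum_le_of_support_subsingleton (weight_shorterRequests_le he c n) ?_
        intro T T' h h'
        exact le_antisymm (not_lt.1 (huniq c n T' T h' h)) (not_lt.1 (huniq c n T T' h h'))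
    _ = ∑' n, lengthMass e n := by
        simp_rw [ENNReal.tsum_mul_left]
        rw [ENNReal.tsum_mul_right, tsum_half_pow_succ, one_mul]
    _ ≤ 1 := (tsum_lengthMass e).trans_le he

theorem computable_stageMass {e : ℕ → Option (ℕ × List Bool)} (he : Computable e) :
    Computable₂ (stageMass e) := by
  refine computable_sum (α := ℕ × ℕ)
    (f := fun p j => scaledWeight p.2 (ofLength p.1 (e j))) ?_ Computable.snd
  have h1 : Computable fun q : (ℕ × ℕ) × ℕ => q.1.1 := Computable.fst.comp Computable.fst
  have h2 : Computable fun q : (ℕ × ℕ) × ℕ => q.1.2 := Computable.snd.comp Computable.fst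
  have h3 : Computable fun q : (ℕ × ℕ) × ℕ => e q.2 := he.comp Computable.snd
  exact computable_scaledWeight h2 (computable_ofLength h1 h3)

theorem computable_exceeds {α : Type*} [Primcodable α] {e : ℕ → Option (ℕ × List Bool)}
    (he : Computable e) {c n T : α → ℕ} (hc : Computable c) (hn : Computable n)
    (hT : Computable T) : Computable fun p => decide (Exceeds e (c p) (n p) (T p)) := by
  have hw : Computable₂ fun (_ : α) (q : ℕ × List Bool) => 2 ^ q.1 :=
    computable_two_pow (Computable.fst.comp Computable.snd)
  have hd : Computable fun p => ((e (n p)).map fun q => 2 ^ q.1).getD 0 :=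
    Computable.option_getD (Computable.option_map (he.comp hn) hw) (Computable.const 0)
  have hS : Computable fun p => stageMass e (n p) (T p) :=
    (computable_stageMass he).comp hn hT
  have hl : Computable fun p => 2 ^ (2 * c p + T p) :=
    computable_two_pow (computable_add (computable_mul (Computable.const 2) hc) hT)
  refine (computable_decide_lt hl (computable_mul hd hS)).of_eq fun p => ?_
  rw [decide_eq_decide]
  unfold Exceeds
  exact Iff.rfl

theorem computable_shorterRequests {e : ℕ → Option (ℕ × List Bool)} (he : Computable e) :
    Computable fun p : ℕ × ℕ × ℕ => shorterRequests e p.1 p.2.1 p.2.2 := by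
  have hn : Computable fun p : ℕ × ℕ × ℕ => p.2.1 := Computable.fst.comp Computable.snd
  have hT : Computable fun p : ℕ × ℕ × ℕ => p.2.2 := Computable.snd.comp Computable.snd
  have hE := computable_exceeds he Computable.fst hn hT
  have hE' := computable_exceeds he Computable.fst hn (computable_add hT (Computable.const 1))
  have ho : Computable fun p : ℕ × ℕ × ℕ =>
      (e p.2.1).map fun q => (q.1 - p.1 + 1, q.2) := by
    refine Computable.option_map (he.comp hn) ?_
    have h1 : Computable fun q : (ℕ × ℕ × ℕ) × ℕ × List Bool => q.2.1 :=
      Computable.fst.comp Computable.snd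
    have h2 : Computable fun q : (ℕ × ℕ × ℕ) × ℕ × List Bool => q.1.1 :=
      Computable.fst.comp Computable.fst
    have h3 : Computable fun q : (ℕ × ℕ × ℕ) × ℕ × List Bool => q.2.2 :=
      Computable.snd.comp Computable.snd
    exact (computable_add (computable_sub h1 h2) (Computable.const 1)).pair h3
  refine (computable_ite (computable_decide_and hE' (computable_decide_not hE))
    ho (Computable.const none)).of_eq fun p => ?_
  rw [shorterRequests]

/-- Otherwise, for every `c`, almost all halting computations get a request for a program shorter by
`c - 1`. For large `c` this contradicts the minimality of a shortest program of a string that has no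
early programs. -/
theorem UniversalRequests.frequently_lengthMass_le {e : ℕ → Option (ℕ × List Bool)}
    (he : UniversalRequests e) : ∃ c : ℕ, ∃ᶠ n in atTop, ∃ d τ, e n = some (d, τ) ∧
      2 ^ d * lengthMass e n ≤ 2 ^ (2 * c) := by
  by_contra hcon
  push Not at hcon
  let r : ℕ → Option (ℕ × List Bool) := fun i =>
    shorterRequests e i.unpair.1 i.unpair.2.unpair.1 i.unpair.2.unpair.2
  have hr : Computable r := by
    have h2 : Computable fun i : ℕ => i.unpair.2.unpair :=
      Computable.unpair.comp (Computable.snd.comp Computable.unpair)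
    have h3 : Computable fun i : ℕ => (i.unpair.1, i.unpair.2.unpair) :=
      (Computable.fst.comp Computable.unpair).pair h2
    exact (computable_shorterRequests he.computable).comp h3
  have hsum : ∑' i, weight (r i) ≤ 1 := by
    rw [tsum_unpair (f := fun c k => weight (shorterRequests e c k.unpair.1 k.unpair.2))]
    rw [tsum_congr fun c => tsum_unpair fun n T => weight (shorterRequests e c n T)]
    exact tsum_shorterRequests_le he.tsum_le
  obtain ⟨c', hc'⟩ := he.exists_const r hr hsum
  -- With `c = c' + 2` the request saves `c' + 1` bits, one more than the overhead `c'`.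
  obtain ⟨N, hN⟩ := eventually_atTop.1 (hcon (c' + 2))
  -- A string not output by the first `N` computations has all its programs at indices from `N` on,
  -- in particular a shortest one.
  obtain ⟨τ, hτ⟩ : ∃ τ : List Bool, τ ∉ (Finset.range N).image fun j => ((e j).map Prod.snd).getD [] :=
    Infinite.exists_notMem_finset _
  have hex : ∃ d j, e j = some (d, τ) := by
    obtain ⟨j, d, h⟩ := he.exists_program τ
    exact ⟨d, j, h⟩
  classical
  obtain ⟨n, hn⟩ := Nat.find_spec hex
  set d := Nat.find hex
  have hmin : ∀ j d', e j = some (d', τ) → d ≤ d' := fun j d' h => Nat.find_min' hex ⟨j, h⟩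
  have hnN : N ≤ n := by
    by_contra hlt
    refine hτ (Finset.mem_image.2 ⟨n, Finset.mem_range.2 (not_le.1 hlt), ?_⟩)
    simp [hn]
  have hgt := hN n hnN d τ hn
  obtain ⟨T, hT⟩ : ∃ T, Exceeds e (c' + 2) n T := by
    have hlt : (2 : ℝ≥0∞) ^ (2 * (c' + 2)) * 2⁻¹ ^ d < lengthMass e n := by
      rw [← ENNReal.mul_lt_mul_iff_right (a := 2 ^ d) (by simp) (by simp), mul_left_comm,
        two_pow_mul_half_pow_self, mul_one]
      exact hgt
    obtain ⟨T, hT⟩ := exists_lt_stageMass hlt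
    refine ⟨T, ?_⟩
    rw [← ENNReal.mul_lt_mul_iff_right (a := 2 ^ d) (by simp) (by simp)] at hT
    have e1 : (2 : ℝ≥0∞) ^ d * (2 ^ T * (2 ^ (2 * (c' + 2)) * 2⁻¹ ^ d)) =
        2 ^ (2 * (c' + 2) + T) * (2 ^ d * 2⁻¹ ^ d) := by ring
    rw [e1, two_pow_mul_half_pow_self, mul_one] at hT
    unfold Exceeds
    rw [hn]
    have : (2 : ℝ≥0∞) ^ (2 * (c' + 2) + T) < ((2 ^ d : ℕ) : ℝ≥0∞) * stageMass e n T := by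
      exact_mod_cast hT
    exact_mod_cast this
  have h0 : ¬ Exceeds e (c' + 2) n 0 := by
    unfold Exceeds
    simp [stageMass]
  have hT' : ∃ T, Exceeds e (c' + 2) n (T + 1) ∧ ¬ Exceeds e (c' + 2) n T := by
    by_contra hno
    push Not at hno
    have hall : ∀ k, ¬ Exceeds e (c' + 2) n k := by
      intro k
      induction k with
      | zero => exact h0
      | succ k ih => exact fun h => ih (hno k h)
    exact hall T hT
  obtain ⟨T, hT1, hT2⟩ := hT'
  have hreq : r (Nat.pair (c' + 2) (Nat.pair n T)) = some (d - (c' + 2) + 1, τ) := by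
    simp only [r, Nat.unpair_pair, shorterRequests]
    rw [if_pos ⟨hT1, hT2⟩, hn]
    rfl
  obtain ⟨j, d', hj, hle⟩ := hc' _ _ _ hreq
  have h1 := hmin j d' hj
  have h2 := hT1.two_mul_le he.tsum_le hn
  omega

/-! ### Enumeration of the strings of a given length -/

/-- The string of length `n` formed by the `n` least significant bits of `i`. -/
def bitString (n i : ℕ) : List Bool := (List.range n).map i.testBit

@[simp] theorem length_bitString (n i : ℕ) : (bitString n i).length = n := by simp [bitString]

theorem bitString_injOn {n i j : ℕ} (hi : i < 2 ^ n) (hj : j < 2 ^ n)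
    (h : bitString n i = bitString n j) : i = j := by
  refine Nat.eq_of_testBit_eq fun k => ?_
  by_cases hk : k < n
  · exact List.map_inj_left.1 h k (List.mem_range.2 hk)
  · have hle : 2 ^ n ≤ 2 ^ k := Nat.pow_le_pow_right (by norm_num) (not_lt.1 hk)
    rw [Nat.testBit_lt_two_pow (hi.trans_le hle), Nat.testBit_lt_two_pow (hj.trans_le hle)]

theorem exists_bitString_eq (σ : List Bool) : ∃ i < 2 ^ σ.length, bitString σ.length i = σ := by
  refine ⟨Nat.ofBits fun k : Fin σ.length => σ[k], Nat.ofBits_lt_two_pow _, ?_⟩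
  refine List.ext_getElem (by simp) fun k h1 h2 => ?_
  simp [bitString, Nat.testBit_ofBits_lt _ _ h2]

theorem computable_bitString : Computable₂ bitString := by
  refine Primrec.to_comp ?_
  refine Primrec.list_map (Primrec.list_range.comp Primrec.fst) ?_
  have h1 : Primrec fun q : (ℕ × ℕ) × ℕ => q.1.2 := Primrec.snd.comp Primrec.fst
  have h2 : Primrec fun q : (ℕ × ℕ) × ℕ => 2 ^ q.2 :=
    (Primrec₂.unpaired'.1 Nat.Primrec.pow).comp (Primrec.const 2) Primrec.snd
  have h3 : Primrec fun q : (ℕ × ℕ) × ℕ => q.1.2 / 2 ^ q.2 % 2 :=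
    Primrec.nat_mod.comp (Primrec.nat_div.comp h1 h2) (Primrec.const 2)
  refine (Primrec.eq.decide.comp h3 (Primrec.const 1)).of_eq fun q => ?_
  exact Nat.testBit_eq_decide_div_mod_eq.symm

/-! ### Sets of sequences that are determined by finitely many bits -/

theorem setOf_restrict_eq (m : ℕ) (P : List Bool → Prop) :
    {X : Cantor | P (restrict X m)} =
      ⋃ i ∈ {i | i < 2 ^ m ∧ P (bitString m i)}, cylinder (bitString m i) := by
  ext X
  simp only [Set.mem_iUnion, Set.mem_ofPred_eq, cylinder, length_bitString, exists_prop]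
  constructor
  · intro h
    obtain ⟨i, hi, he⟩ := exists_bitString_eq (restrict X m)
    rw [length_restrict] at hi he
    exact ⟨i, ⟨hi, he ▸ h⟩, he.symm⟩
  · rintro ⟨i, ⟨_, hP⟩, he⟩
    rwa [he]

theorem measurableSet_restrict (m : ℕ) (P : List Bool → Prop) :
    MeasurableSet {X : Cantor | P (restrict X m)} := by
  rw [setOf_restrict_eq]
  exact MeasurableSet.biUnion (Set.to_countable _) fun _ _ => measurableSet_cylinder _

theorem lebesgue_restrict (m : ℕ) (P : List Bool → Prop) [DecidablePred P] :
    lebesgue {X : Cantor | P (restrict X m)} =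
      (∑ i ∈ Finset.range (2 ^ m), if P (bitString m i) then 1 else 0 : ℕ) * 2⁻¹ ^ m := by
  have hset : {i | i < 2 ^ m ∧ P (bitString m i)} =
      ((Finset.range (2 ^ m)).filter fun i => P (bitString m i) : Finset ℕ) := by
    ext i; simp
  rw [setOf_restrict_eq, hset]
  simp only [Finset.mem_coe]
  rw [measure_biUnion_finset]
  · simp only [lebesgue_cylinder, length_bitString]
    rw [Finset.sum_const, nsmul_eq_mul, Finset.card_filter]
  · intro i hi j hj hij
    simp only [Finset.coe_filter, Finset.mem_range, Set.mem_ofPred_eq] at hi hj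
    have hne : bitString m i ≠ bitString m j := fun h => hij (bitString_injOn hi.1 hj.1 h)
    exact disjoint_cylinder (fun h => hne (h.eq_of_length (by simp)))
      fun h => hne (h.eq_of_length (by simp)).symm
  · exact fun _ _ => measurableSet_cylinder _

/-! ### Approximations of a Turing functional -/

theorem exists_enumeration {α : Type*} [Primcodable α] {p : α → Prop} (hp : REPred p) :
    ∃ g : ℕ → Option α, Computable g ∧ ∀ a, p a ↔ ∃ j, g j = some a := by
  obtain ⟨c, hc⟩ := Nat.Partrec.Code.exists_code.1 hp
  have hc' : ∀ a, p a ↔ ∃ k, (Nat.Partrec.Code.evaln k c (Encodable.encode a)).isSome := by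
    intro a
    have h1 : p a ↔ (c.eval (Encodable.encode a)).Dom := by
      rw [hc]
      simp [Part.assert]
    rw [h1, Part.dom_iff_mem]
    simp_rw [Nat.Partrec.Code.evaln_complete, Option.isSome_iff_exists]
    exact exists_comm
  let g : ℕ → Option α := fun i => (Encodable.decode (α := α) i.unpair.1).bind fun a =>
    if (Nat.Partrec.Code.evaln i.unpair.2 c (Encodable.encode a)).isSome then some a else none
  refine ⟨g, ?_, fun a => ?_⟩
  · refine Computable.option_bind
      (Computable.decode.comp (Computable.fst.comp Computable.unpair)) ?_
    have h1 : Computable fun q : ℕ × α => q.1.unpair.2 :=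
      Computable.snd.comp (Computable.unpair.comp Computable.fst)
    have h2 : Computable fun q : ℕ × α =>
        Nat.Partrec.Code.evaln q.1.unpair.2 c (Encodable.encode q.2) :=
      Nat.Partrec.Code.primrec_evaln.to_comp.comp
        ((h1.pair (Computable.const c)).pair (Computable.encode.comp Computable.snd))
    refine (Computable.cond (Primrec.option_isSome.to_comp.comp h2)
      (Computable.option_some.comp Computable.snd) (Computable.const none)).of_eq fun q => ?_
    exact Bool.cond_eq_ite _ _ _
  · rw [hc']
    constructor
    · rintro ⟨k, hk⟩
      exact ⟨Nat.pair (Encodable.encode a) k, by simp [g, hk]⟩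
    · rintro ⟨j, hj⟩
      obtain ⟨b, _, h⟩ := Option.bind_eq_some_iff.1 hj
      split_ifs at h with hs
      cases h
      exact ⟨_, hs⟩

/-- With an oracle that extends `ρ`, the functional enumerated by `g` produces an extension of `τ`,
as witnessed by one of the first `|ρ|` pairs. -/
def Produces (g : ℕ → Option (List Bool × List Bool)) (ρ τ : List Bool) : Prop :=
  ∃ j < ρ.length, ∃ p ∈ g j, p.1 <+: ρ ∧ τ <+: p.2

theorem Produces.mono {g : ℕ → Option (List Bool × List Bool)} {ρ ρ' τ τ' : List Bool}
    (h : Produces g ρ τ) (hρ : ρ <+: ρ') (hτ : τ' <+: τ) : Produces g ρ' τ' := by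
  obtain ⟨j, hj, p, hp, h1, h2⟩ := h
  exact ⟨j, hj.trans_le hρ.length_le, p, hp, h1.trans hρ, hτ.trans h2⟩

theorem computable_isPrefix {α : Type*} [Primcodable α] {f g : α → List Bool} (hf : Computable f)
    (hg : Computable g) : Computable fun a => decide (f a <+: g a) := by
  refine (computable_decide_eq hf (Primrec.list_take.to_comp.comp
    (Computable.list_length.comp hf) hg)).of_eq fun a => ?_
  rw [decide_eq_decide, List.prefix_iff_eq_take]

noncomputable instance (g : ℕ → Option (List Bool × List Bool)) (ρ τ : List Bool) :
    Decidable (Produces g ρ τ) :=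
  Classical.propDecidable _

theorem computable_produces {α : Type*} [Primcodable α] {g : ℕ → Option (List Bool × List Bool)}
    (hg : Computable g) {ρ τ : α → List Bool} (hρ : Computable ρ) (hτ : Computable τ) :
    Computable fun a => decide (Produces g (ρ a) (τ a)) := by
  have hw : Computable fun q : (α × ℕ) × List Bool × List Bool =>
      if q.2.1 <+: ρ q.1.1 ∧ τ q.1.1 <+: q.2.2 then 1 else 0 := by
    have h1 : Computable fun q : (α × ℕ) × List Bool × List Bool => q.1.1 :=
      Computable.fst.comp Computable.fst
    have h2 : Computable fun q : (α × ℕ) × List Bool × List Bool => q.2.1 :=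
      Computable.fst.comp Computable.snd
    have h3 : Computable fun q : (α × ℕ) × List Bool × List Bool => q.2.2 :=
      Computable.snd.comp Computable.snd
    exact computable_ite (computable_decide_and (computable_isPrefix h2 (hρ.comp h1))
      (computable_isPrefix (hτ.comp h1) h3)) (Computable.const 1) (Computable.const 0)
  have hs : Computable fun q : α × ℕ => ((g q.2).map fun p =>
      if p.1 <+: ρ q.1 ∧ τ q.1 <+: p.2 then 1 else 0).getD 0 :=
    Computable.option_getD (Computable.option_map (hg.comp Computable.snd) hw) (Computable.const 0)
  have hsum : Computable fun a => ∑ j ∈ Finset.range (ρ a).length, ((g j).map fun p =>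
      if p.1 <+: ρ a ∧ τ a <+: p.2 then 1 else 0).getD 0 :=
    computable_sum hs (Computable.list_length.comp hρ)
  refine (computable_decide_lt (Computable.const 0) hsum).of_eq fun a => ?_
  rw [decide_eq_decide, Finset.sum_pos_iff]
  constructor
  · rintro ⟨j, hj, h⟩
    rcases hgj : g j with _ | p
    · simp [hgj] at h
    · rw [hgj] at h
      simp only [Option.map_some, Option.getD_some] at h
      split_ifs at h with hp
      · exact ⟨j, Finset.mem_range.1 hj, p, hgj, hp⟩
      · simp at h
  · rintro ⟨j, hj, p, hp, h⟩
    refine ⟨j, Finset.mem_range.2 hj, ?_⟩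
    rw [Option.mem_def.1 hp]
    simp [h]

/-- The number of strings of length `m` with which `τ` is produced. -/
noncomputable def produceCount (g : ℕ → Option (List Bool × List Bool)) (m : ℕ) (τ : List Bool) :
    ℕ :=
  ∑ i ∈ Finset.range (2 ^ m), if Produces g (bitString m i) τ then 1 else 0

theorem computable_produceCount {α : Type*} [Primcodable α]
    {g : ℕ → Option (List Bool × List Bool)} (hg : Computable g) {m : α → ℕ} {τ : α → List Bool}
    (hm : Computable m) (hτ : Computable τ) : Computable fun a => produceCount g (m a) (τ a) := by
  have h1 : Computable fun q : α × ℕ => bitString (m q.1) q.2 :=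
    computable_bitString.comp (hm.comp Computable.fst) Computable.snd
  have h2 : Computable fun q : α × ℕ => τ q.1 := hτ.comp Computable.fst
  exact computable_sum (computable_ite (computable_produces hg h1 h2) (Computable.const 1)
    (Computable.const 0)).to₂ (computable_two_pow hm)

theorem lebesgue_produces (g : ℕ → Option (List Bool × List Bool)) (m : ℕ) (τ : List Bool) :
    lebesgue {X | Produces g (restrict X m) τ} = produceCount g m τ * 2⁻¹ ^ m :=
  lebesgue_restrict m fun ρ => Produces g ρ τ

theorem produceCount_le (g : ℕ → Option (List Bool × List Bool)) (m : ℕ) (τ : List Bool) :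
    produceCount g m τ ≤ 2 ^ m := by
  calc produceCount g m τ ≤ ∑ i ∈ Finset.range (2 ^ m), 1 :=
        Finset.sum_le_sum fun i _ => by split_ifs <;> simp
    _ = 2 ^ m := by simp

theorem produceCount_pos {g : ℕ → Option (List Bool × List Bool)} {X : Cantor} {m : ℕ}
    {τ : List Bool} (h : Produces g (restrict X m) τ) : 0 < produceCount g m τ := by
  obtain ⟨i, hi, he⟩ := exists_bitString_eq (restrict X m)
  rw [length_restrict] at hi he
  refine Finset.sum_pos_iff.2 ⟨i, Finset.mem_range.2 hi, ?_⟩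
  rw [he, if_pos h]
  exact one_pos

/-- The oracles with which a string of length `n` is produced from the first `m` bits. -/
def producers (g : ℕ → Option (List Bool × List Bool)) (n m : ℕ) : Set Cantor :=
  {X | ∃ τ, τ.length = n ∧ Produces g (restrict X m) τ}

theorem measurableSet_producers (g : ℕ → Option (List Bool × List Bool)) (n m : ℕ) :
    MeasurableSet (producers g n m) :=
  measurableSet_restrict m fun ρ => ∃ τ : List Bool, τ.length = n ∧ Produces g ρ τ

theorem producers_mono (g : ℕ → Option (List Bool × List Bool)) (n : ℕ) :
    Monotone (producers g n) := by
  rintro m m' h X ⟨τ, hτ, hp⟩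
  exact ⟨τ, hτ, hp.mono (restrict_prefix X h) List.prefix_rfl⟩

theorem producers_anti (g : ℕ → Option (List Bool × List Bool)) (m : ℕ) {n n' : ℕ} (h : n ≤ n') :
    producers g n' m ⊆ producers g n m := by
  rintro X ⟨τ, hτ, hp⟩
  exact ⟨τ.take n, by simp [hτ, h], hp.mono List.prefix_rfl (List.take_prefix _ _)⟩

theorem producers_eq (g : ℕ → Option (List Bool × List Bool)) (n m : ℕ) :
    producers g n m =
      ⋃ j ∈ Finset.range (2 ^ n), {X | Produces g (restrict X m) (bitString n j)} := by
  ext X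
  simp only [producers, Set.mem_ofPred_eq, Set.mem_iUnion, Finset.mem_range, exists_prop]
  constructor
  · rintro ⟨τ, rfl, h⟩
    obtain ⟨j, hj, he⟩ := exists_bitString_eq τ
    exact ⟨j, hj, he.symm ▸ h⟩
  · rintro ⟨j, _, h⟩
    exact ⟨_, length_bitString _ _, h⟩

/-- An enumeration of the graph of `Φ`. -/
def Enumerates (g : ℕ → Option (List Bool × List Bool)) (Φ : TuringFunctional) : Prop :=
  ∀ p, p ∈ Φ.graph ↔ ∃ j, g j = some p

/-- The oracle parts of both witnesses are prefixes of `ρ`, hence comparable, so consistency of `Φ`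
applies. Thus different strings of one length are produced on disjoint sets of oracles. -/
theorem Enumerates.produces_unique {g : ℕ → Option (List Bool × List Bool)} {Φ : TuringFunctional}
    (hg : Enumerates g Φ) {ρ τ τ' : List Bool} (h : Produces g ρ τ) (h' : Produces g ρ τ')
    (hl : τ.length = τ'.length) : τ = τ' := by
  obtain ⟨j, _, ⟨σ, υ⟩, hj, h1, h2⟩ := h
  obtain ⟨j', _, ⟨σ', υ'⟩, hj', h1', h2'⟩ := h'
  have hm : (σ, υ) ∈ Φ.graph := (hg _).2 ⟨j, hj⟩
  have hm' : (σ', υ') ∈ Φ.graph := (hg _).2 ⟨j', hj'⟩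
  have hc : υ <+: υ' ∨ υ' <+: υ := by
    rcases List.prefix_or_prefix_of_prefix h1 h1' with h | h
    · exact Φ.consistent _ _ _ _ hm hm' h
    · exact (Φ.consistent _ _ _ _ hm' hm h).symm
  rcases hc with h | h
  · exact (List.prefix_of_prefix_length_le (h2.trans h) h2' hl.le).eq_of_length hl
  · exact (List.prefix_of_prefix_length_le h2 (h2'.trans h) hl.le).eq_of_length hl

theorem Enumerates.lebesgue_producers {g : ℕ → Option (List Bool × List Bool)}
    {Φ : TuringFunctional} (hg : Enumerates g Φ) (n m : ℕ) :
    lebesgue (producers g n m) =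
      (∑ j ∈ Finset.range (2 ^ n), produceCount g m (bitString n j) : ℕ) * 2⁻¹ ^ m := by
  rw [producers_eq, measure_biUnion_finset]
  · simp_rw [lebesgue_produces]
    rw [← Finset.sum_mul, Nat.cast_sum]
  · intro i hi j hj hij
    simp only [Finset.coe_range, Set.mem_Iio] at hi hj
    rw [Function.onFun, Set.disjoint_left]
    intro X hX hX'
    exact hij (bitString_injOn hi hj (hg.produces_unique hX hX' (by simp)))
  · exact fun j _ => measurableSet_restrict m fun ρ => Produces g ρ (bitString n j)

theorem Enumerates.eq_restrict {g : ℕ → Option (List Bool × List Bool)} {Φ : TuringFunctional}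
    (hg : Enumerates g Φ) {X Y : Cantor} (h : Φ.Maps X Y) {m : ℕ} {τ : List Bool}
    (hp : Produces g (restrict X m) τ) : τ = restrict Y τ.length := by
  obtain ⟨j, _, ⟨σ, υ⟩, hj, h1, h2⟩ := hp
  have hm : (σ, υ) ∈ Φ.graph := (hg _).2 ⟨j, hj⟩
  rw [show σ = restrict X σ.length from eq_restrict_of_prefix h1] at hm
  have hυ := h.1 _ _ hm
  dsimp only at h2
  rw [hυ] at h2
  exact eq_restrict_of_prefix h2

theorem Enumerates.mem_producers {g : ℕ → Option (List Bool × List Bool)} {Φ : TuringFunctional}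
    (hg : Enumerates g Φ) {X Y : Cantor} (h : Φ.Maps X Y) (n : ℕ) :
    ∃ m, X ∈ producers g n m := by
  obtain ⟨m, τ, hm, hn⟩ := h.2 n
  obtain ⟨j, hj⟩ := (hg _).1 hm
  refine ⟨max m (j + 1), τ.take n, by simp [hn], j, ?_, _, hj, ?_, List.take_prefix _ _⟩
  · rw [length_restrict]; omega
  · exact restrict_prefix X (le_max_left _ _)

/-! ### Codes of Shannon–Fano length -/

theorem exists_computable_codeLength : ∃ ℓ : ℕ → ℕ → ℕ, Computable₂ ℓ ∧
    ∀ m c, 0 < c → c ≤ 2 ^ m → 2 ^ m ≤ 2 ^ ℓ m c * c ∧ 2 ^ ℓ m c * c ≤ 2 * 2 ^ m := by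
  -- With truncated subtraction the second factor is `max p.2 1`, so that the search also ends when
  -- the count is zero.
  have hex : ∀ p : ℕ × ℕ, ∃ k, 2 ^ p.1 ≤ 2 ^ k * (p.2 + (1 - p.2)) := fun p =>
    ⟨p.1, Nat.le_mul_of_pos_right _ (by omega)⟩
  have hcomp : ComputablePred fun q : (ℕ × ℕ) × ℕ =>
      2 ^ q.1.1 ≤ 2 ^ q.2 * (q.1.2 + (1 - q.1.2)) := by
    refine Computable.computablePred ?_
    have h1 : Computable fun q : (ℕ × ℕ) × ℕ => q.1.1 := Computable.fst.comp Computable.fst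
    have h2 : Computable fun q : (ℕ × ℕ) × ℕ => q.1.2 := Computable.snd.comp Computable.fst
    exact computable_decide_le (computable_two_pow h1) (computable_mul
      (computable_two_pow Computable.snd)
      (computable_add h2 (computable_sub (Computable.const 1) h2)))
  refine ⟨fun m c => Nat.find (hex (m, c)), Computable.find hcomp hex, fun m c hc hcm => ?_⟩
  change 2 ^ m ≤ 2 ^ Nat.find (hex (m, c)) * c ∧ 2 ^ Nat.find (hex (m, c)) * c ≤ 2 * 2 ^ m
  have hspec := Nat.find_spec (hex (m, c))
  have hmin := fun k => Nat.find_min (hex (m, c)) (m := k)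
  generalize Nat.find (hex (m, c)) = k at hspec hmin ⊢
  have e1 : c + (1 - c) = c := by omega
  simp only [e1, not_le] at hspec hmin
  refine ⟨hspec, ?_⟩
  rcases k with _ | k
  · simp only [pow_zero, one_mul]; omega
  · calc 2 ^ (k + 1) * c = 2 * (2 ^ k * c) := by ring
      _ ≤ 2 * 2 ^ m := by have := hmin k (Nat.lt_succ_self k); omega

/-! ### Computable time bounds for computable requests -/

/-- The request `o'` is for the string requested by `o`, with a program that is longer by at most
`c`; or there is no request `o`. -/
@[irreducible] def Serves (c : ℕ) (o' o : Option (ℕ × List Bool)) : Prop :=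
  ∀ p ∈ o, ∃ p' ∈ o', p'.2 = p.2 ∧ p'.1 ≤ p.1 + c

theorem Serves.exists_mem {c : ℕ} {o' o : Option (ℕ × List Bool)} (h : Serves c o' o)
    {p : ℕ × List Bool} (hp : p ∈ o) : ∃ p' ∈ o', p'.2 = p.2 ∧ p'.1 ≤ p.1 + c := by
  unfold Serves at h
  exact h p hp

noncomputable instance (c : ℕ) (o' o : Option (ℕ × List Bool)) : Decidable (Serves c o' o) :=
  Classical.propDecidable _

theorem computable_serves {α : Type*} [Primcodable α] (c : ℕ)
    {o' o : α → Option (ℕ × List Bool)} (ho' : Computable o') (ho : Computable o) :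
    Computable fun a => decide (Serves c (o' a) (o a)) := by
  have hi : Computable fun q : (α × ℕ × List Bool) × ℕ × List Bool =>
      decide (q.2.2 = q.1.2.2 ∧ q.2.1 ≤ q.1.2.1 + c) := by
    have h1 : Computable fun q : (α × ℕ × List Bool) × ℕ × List Bool => q.2.2 :=
      Computable.snd.comp Computable.snd
    have h2 : Computable fun q : (α × ℕ × List Bool) × ℕ × List Bool => q.1.2 :=
      Computable.snd.comp Computable.fst
    have h3 : Computable fun q : (α × ℕ × List Bool) × ℕ × List Bool => q.2.1 :=
      Computable.fst.comp Computable.snd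
    exact computable_decide_and (computable_decide_eq h1 (Computable.snd.comp h2))
      (computable_decide_le h3 (computable_add (Computable.fst.comp h2) (Computable.const c)))
  have hj : Computable fun q : α × ℕ × List Bool =>
      ((o' q.1).map fun p' => decide (p'.2 = q.2.2 ∧ p'.1 ≤ q.2.1 + c)).getD false :=
    Computable.option_getD (Computable.option_map (ho'.comp Computable.fst) hi)
      (Computable.const false)
  have hk : Computable fun a => ((o a).map fun p =>
      ((o' a).map fun p' => decide (p'.2 = p.2 ∧ p'.1 ≤ p.1 + c)).getD false).getD true :=
    Computable.option_getD (Computable.option_map ho hj) (Computable.const true)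
  refine hk.of_eq fun a => ?_
  rw [Bool.eq_iff_iff, decide_eq_true_iff]
  unfold Serves
  rcases o a with _ | p
  · simp
  · rcases o' a with _ | p' <;> simp

/-- `R` is total and computable and each of its requests is served, so the first serving index is
found by a terminating search. Summing these indices over all `j < 2 ^ n` and all lengths up to `N`
gives a bound that is monotone by construction. -/
theorem UniversalRequests.exists_time_bound {e : ℕ → Option (ℕ × List Bool)}
    (he : UniversalRequests e) {R : ℕ → ℕ → Option (ℕ × List Bool)} (hR : Computable₂ R)
    (hs : ∑' n, ∑' j, weight (R n j) ≤ 1) :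
    ∃ (c : ℕ) (t : ℕ → ℕ), Computable t ∧ Monotone t ∧
      ∀ n j d τ, j < 2 ^ n → R n j = some (d, τ) →
        ∃ k d', e k = some (d', τ) ∧ d' ≤ d + c ∧ k ≤ t n := by
  have hunp : Computable fun i : ℕ => R i.unpair.1 i.unpair.2 :=
    hR.comp (Computable.fst.comp Computable.unpair) (Computable.snd.comp Computable.unpair)
  obtain ⟨c, hc⟩ := he.exists_const (fun i => R i.unpair.1 i.unpair.2) hunp
    (by rwa [tsum_unpair fun n j => weight (R n j)])
  have hex : ∀ q : ℕ × ℕ, ∃ k, Serves c (e k) (R q.1 q.2) := by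
    rintro ⟨n, j⟩
    unfold Serves
    rcases h : R n j with _ | ⟨d, τ⟩
    · exact ⟨0, by simp⟩
    · obtain ⟨k, d', hk, hle⟩ := hc (Nat.pair n j) d τ (by simp [h])
      exact ⟨k, by simp [hk, hle]⟩
  have hR' : Computable fun q : (ℕ × ℕ) × ℕ => R q.1.1 q.1.2 :=
    hR.comp (Computable.fst.comp Computable.fst) (Computable.snd.comp Computable.fst)
  have hfind : Computable fun q => Nat.find (hex q) :=
    Computable.find (computable_serves c (he.computable.comp Computable.snd) hR').computablePred hex
  have hinner : Computable fun n => ∑ j ∈ Finset.range (2 ^ n), Nat.find (hex (n, j)) :=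
    computable_sum (f := fun n j => Nat.find (hex (n, j))) hfind
      (computable_two_pow Computable.id)
  refine ⟨c, fun N => ∑ n ∈ Finset.range (N + 1), ∑ j ∈ Finset.range (2 ^ n),
    Nat.find (hex (n, j)), ?_, ?_, ?_⟩
  · exact computable_sum (hinner.comp Computable.snd).to₂ Computable.succ
  · intro N N' h
    exact Finset.sum_le_sum_of_subset (Finset.range_mono (by omega))
  · intro n j d τ hj h
    have hspec := Nat.find_spec (hex (n, j))
    have hle : Nat.find (hex (n, j)) ≤ ∑ n ∈ Finset.range (n + 1), ∑ j ∈ Finset.range (2 ^ n),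
        Nat.find (hex (n, j)) :=
      (Finset.single_le_sum (f := fun j => Nat.find (hex (n, j))) (fun _ _ => Nat.zero_le _)
        (Finset.mem_range.2 hj)).trans
      (Finset.single_le_sum (f := fun n => ∑ j ∈ Finset.range (2 ^ n), Nat.find (hex (n, j)))
        (fun _ _ => Nat.zero_le _) (Finset.mem_range.2 (Nat.lt_succ_self n)))
    obtain ⟨⟨d', τ'⟩, hk, rfl, hd⟩ := hspec.exists_mem h
    exact ⟨_, d', hk, hd, hle⟩

/-! ### The measure of the oracles whose output is compressible -/

/-- The oracles with which a string of length `n` is produced from the first `m` bits that has a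
program whose length is by more than `a` below `d j`, where `j` is the index of the string. -/
def compressible (e : ℕ → Option (ℕ × List Bool)) (g : ℕ → Option (List Bool × List Bool))
    (n m a : ℕ) (d : ℕ → ℕ) : Set Cantor :=
  {X | ∃ j < 2 ^ n, Produces g (restrict X m) (bitString n j) ∧
    ∃ k d', e k = some (d', bitString n j) ∧ d' + a < d j}

theorem tsum_weight_bitString_le (e : ℕ → Option (ℕ × List Bool)) (n : ℕ) :
    ∑' j, ∑' k, (if j < 2 ^ n ∧ (e k).map Prod.snd = some (bitString n j)
      then weight (e k) else 0) ≤ lengthMass e n := by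
  rw [ENNReal.tsum_comm, lengthMass]
  refine ENNReal.tsum_le_tsum fun k => tsum_le_of_support_subsingleton (fun j => ?_) ?_
  · split_ifs with h
    · obtain ⟨p, hp, hs⟩ := Option.map_eq_some_iff.1 h.2
      rw [hp, ofLength_some, if_pos (by rw [hs]; simp)]
    · exact zero_le
  · intro i j hi hj
    have hi' := (ite_ne_right_iff.1 hi).1
    have hj' := (ite_ne_right_iff.1 hj).1
    exact bitString_injOn hi'.1 hj'.1 (Option.some.inj (hi'.2.symm.trans hj'.2))

/-- A string with code length `L` is produced with probability at most `2 * 2 ^ (-L)`. If it has a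
program of length `d'` with `d' + a < d₀ + L`, this is at most `2 * 2 ^ (-a) * 2 ^ d₀ * 2 ^ (-d')`,
and the weights `2 ^ (-d')` for strings of length `n` sum to at most `lengthMass e n`. -/
theorem lebesgue_compressible_le {e : ℕ → Option (ℕ × List Bool)}
    {g : ℕ → Option (List Bool × List Bool)} {n m a d₀ c : ℕ} {ℓ : ℕ → ℕ → ℕ}
    (hℓ : ∀ m c, 0 < c → c ≤ 2 ^ m → 2 ^ m ≤ 2 ^ ℓ m c * c ∧ 2 ^ ℓ m c * c ≤ 2 * 2 ^ m)
    (hn : 2 ^ d₀ * lengthMass e n ≤ 2 ^ (2 * c)) :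
    lebesgue (compressible e g n m a fun j => d₀ + ℓ m (produceCount g m (bitString n j))) ≤
      2 ^ (2 * c + 1) * 2⁻¹ ^ a := by
  set d : ℕ → ℕ := fun j => d₀ + ℓ m (produceCount g m (bitString n j)) with hd
  let B : ℕ → Set Cantor := fun j => {X | j < 2 ^ n ∧ Produces g (restrict X m) (bitString n j) ∧
    ∃ k d', e k = some (d', bitString n j) ∧ d' + a < d j}
  have hB : compressible e g n m a d ⊆ ⋃ j, B j := by
    rintro X ⟨j, hj, h⟩
    exact Set.mem_iUnion.2 ⟨j, hj, h⟩
  have hBj : ∀ j, lebesgue (B j) ≤ 2 * 2⁻¹ ^ a * 2 ^ d₀ *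
      ∑' k, (if j < 2 ^ n ∧ (e k).map Prod.snd = some (bitString n j)
        then weight (e k) else 0) := by
    intro j
    rcases (B j).eq_empty_or_nonempty with h0 | ⟨X, hj, hX, k, d', hk, hlt⟩
    · simp [h0]
    · set C := produceCount g m (bitString n j) with hC
      set L := ℓ m C with hL
      have hCpos : 0 < C := produceCount_pos hX
      have h2 := (hℓ m C hCpos (produceCount_le _ _ _)).2
      have h2' : (2 : ℝ≥0∞) ^ L * C ≤ 2 * 2 ^ m := by exact_mod_cast h2
      have hlt' : d' + a ≤ d₀ + L := hlt.le
      have h3 : (2⁻¹ : ℝ≥0∞) ^ (d₀ + L) ≤ 2⁻¹ ^ (d' + a) :=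
        pow_le_pow_right_of_le_one' (by simp) hlt'
      have h4 : (2⁻¹ : ℝ≥0∞) ^ d' ≤
          ∑' k, (if j < 2 ^ n ∧ (e k).map Prod.snd = some (bitString n j)
            then weight (e k) else 0) := by
        refine le_trans ?_ (ENNReal.le_tsum k)
        rw [if_pos ⟨hj, by rw [hk]; rfl⟩, hk, weight_some]
      calc lebesgue (B j) ≤ lebesgue {X | Produces g (restrict X m) (bitString n j)} :=
            measure_mono fun X hX => hX.2.1
        _ = C * 2⁻¹ ^ m := lebesgue_produces _ _ _
        _ = 2 ^ d₀ * 2⁻¹ ^ (d₀ + L) * (2 ^ L * C) * 2⁻¹ ^ m := by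
            rw [two_pow_mul_half_pow, ← mul_assoc, mul_comm (2⁻¹ ^ L), two_pow_mul_half_pow_self,
              one_mul]
        _ ≤ 2 ^ d₀ * 2⁻¹ ^ (d' + a) * (2 * 2 ^ m) * 2⁻¹ ^ m := by gcongr
        _ = 2 * 2⁻¹ ^ a * 2 ^ d₀ * 2⁻¹ ^ d' * (2 ^ m * 2⁻¹ ^ m) := by ring
        _ = 2 * 2⁻¹ ^ a * 2 ^ d₀ * 2⁻¹ ^ d' := by rw [two_pow_mul_half_pow_self, mul_one]
        _ ≤ _ := by gcongr
  calc lebesgue (compressible e g n m a d) ≤ ∑' j, lebesgue (B j) :=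
        (measure_mono hB).trans (measure_iUnion_le _)
    _ ≤ ∑' j, 2 * 2⁻¹ ^ a * 2 ^ d₀ *
      ∑' k, (if j < 2 ^ n ∧ (e k).map Prod.snd = some (bitString n j)
        then weight (e k) else 0) := ENNReal.tsum_le_tsum hBj
    _ ≤ 2 * 2⁻¹ ^ a * 2 ^ d₀ * lengthMass e n := by
        rw [ENNReal.tsum_mul_left]
        gcongr
        exact tsum_weight_bitString_le e n
    _ = 2 * 2⁻¹ ^ a * (2 ^ d₀ * lengthMass e n) := by ring
    _ ≤ 2 * 2⁻¹ ^ a * 2 ^ (2 * c) := by gcongr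
    _ = _ := by ring

/-! ### Requests for the strings produced by a functional -/

/-- If `n` is the index of a program of length `d`, request the `j`-th string `τ` of length `n` by a
program of length `d - log (λ {X | τ is produced from the first (m n) bits of X})`. -/
noncomputable def outputRequests (e : ℕ → Option (ℕ × List Bool))
    (g : ℕ → Option (List Bool × List Bool)) (ℓ : ℕ → ℕ → ℕ) (m : ℕ → ℕ) (n j : ℕ) :
    Option (ℕ × List Bool) :=
  if j < 2 ^ n ∧ 0 < produceCount g (m n) (bitString n j) then
    (e n).map fun p => (p.1 + ℓ (m n) (produceCount g (m n) (bitString n j)), bitString n j)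
  else none

theorem computable_outputRequests {e : ℕ → Option (ℕ × List Bool)}
    {g : ℕ → Option (List Bool × List Bool)} {ℓ : ℕ → ℕ → ℕ} {m : ℕ → ℕ} (he : Computable e)
    (hg : Computable g) (hℓ : Computable₂ ℓ) (hm : Computable m) :
    Computable₂ (outputRequests e g ℓ m) := by
  have hmn : Computable fun p : ℕ × ℕ => m p.1 := hm.comp Computable.fst
  have hs : Computable fun p : ℕ × ℕ => bitString p.1 p.2 := computable_bitString
  have hc : Computable fun p : ℕ × ℕ => produceCount g (m p.1) (bitString p.1 p.2) :=
    computable_produceCount hg hmn hs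
  have hl : Computable fun p : ℕ × ℕ => ℓ (m p.1) (produceCount g (m p.1) (bitString p.1 p.2)) :=
    hℓ.comp hmn hc
  have h1 : Computable fun q : (ℕ × ℕ) × ℕ × List Bool => q.2.1 :=
    Computable.fst.comp Computable.snd
  have ho : Computable fun p : ℕ × ℕ => (e p.1).map fun q =>
      (q.1 + ℓ (m p.1) (produceCount g (m p.1) (bitString p.1 p.2)), bitString p.1 p.2) :=
    Computable.option_map (he.comp Computable.fst)
      ((computable_add h1 (hl.comp Computable.fst)).pair (hs.comp Computable.fst)).to₂
  refine (computable_ite (computable_decide_and (computable_decide_lt Computable.snd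
    (computable_two_pow Computable.fst)) (computable_decide_lt (Computable.const 0) hc)) ho
    (Computable.const none)).of_eq fun p => ?_
  rw [outputRequests]

/-- For fixed `n` the Shannon–Fano weights are at most the probabilities of disjoint events, so they
sum to at most one. The remaining factor `weight (e n)` pays for the description of `n` itself. -/
theorem Enumerates.tsum_outputRequests_le {e : ℕ → Option (ℕ × List Bool)}
    {g : ℕ → Option (List Bool × List Bool)} {Φ : TuringFunctional} (hg : Enumerates g Φ)
    (he : ∑' i, weight (e i) ≤ 1) {ℓ : ℕ → ℕ → ℕ} (m : ℕ → ℕ)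
    (hℓ : ∀ m c, 0 < c → c ≤ 2 ^ m → 2 ^ m ≤ 2 ^ ℓ m c * c ∧ 2 ^ ℓ m c * c ≤ 2 * 2 ^ m) :
    ∑' n, ∑' j, weight (outputRequests e g ℓ m n j) ≤ 1 := by
  refine le_trans (ENNReal.tsum_le_tsum fun n => ?_) he
  have hj : ∀ j, weight (outputRequests e g ℓ m n j) ≤ weight (e n) *
      if j ∈ Finset.range (2 ^ n) then
        (produceCount g (m n) (bitString n j) : ℝ≥0∞) * 2⁻¹ ^ m n else 0 := by
    intro j
    rw [outputRequests]
    split_ifs with h h1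
    · rcases hn : e n with _ | ⟨d, τ⟩
      · simp
      · simp only [Option.map_some, weight_some]
        rw [pow_add]
        gcongr
        set C := produceCount g (m n) (bitString n j)
        have h2 := (hℓ (m n) C h.2 (produceCount_le _ _ _)).1
        have h2' : (2 : ℝ≥0∞) ^ m n ≤ 2 ^ ℓ (m n) C * C := by exact_mod_cast h2
        calc (2⁻¹ : ℝ≥0∞) ^ ℓ (m n) C = 2⁻¹ ^ ℓ (m n) C * (2 ^ m n * 2⁻¹ ^ m n) := by
              rw [two_pow_mul_half_pow_self, mul_one]
          _ ≤ 2⁻¹ ^ ℓ (m n) C * (2 ^ ℓ (m n) C * C * 2⁻¹ ^ m n) := by gcongr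
          _ = (2 ^ ℓ (m n) C * 2⁻¹ ^ ℓ (m n) C) * (C * 2⁻¹ ^ m n) := by ring
          _ = C * 2⁻¹ ^ m n := by rw [two_pow_mul_half_pow_self, one_mul]
    · exact absurd (Finset.mem_range.2 h.1) h1
    · simp
    · simp
  calc ∑' j, weight (outputRequests e g ℓ m n j)
      ≤ weight (e n) * ∑' j, if j ∈ Finset.range (2 ^ n) then
          (produceCount g (m n) (bitString n j) : ℝ≥0∞) * 2⁻¹ ^ m n else 0 := by
        rw [← ENNReal.tsum_mul_left]
        exact ENNReal.tsum_le_tsum hj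
    _ = weight (e n) * lebesgue (producers g n (m n)) := by
        rw [hg.lebesgue_producers, Nat.cast_sum, Finset.sum_mul]
        congr 1
        rw [tsum_eq_sum (s := Finset.range (2 ^ n)) fun j hj => if_neg hj]
        exact Finset.sum_congr rfl fun j hj => if_pos hj
    _ ≤ weight (e n) := mul_le_of_le_one_right' prob_le_one

/-! ### Negligibility -/

/-- The oracles from which `Φ` computes a strongly deep sequence. -/
def deepOracles (U : Machine) (Φ : TuringFunctional) : Set Cantor :=
  {X | ∃ Y : Cantor, Φ.Maps X Y ∧ StronglyDeep U Y}

/-- The measure of `producers g n m` is a count divided by `2 ^ m`, so comparing it with a rational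
is decidable and a suitable stage can be searched for. -/
theorem Enumerates.exists_computable_stage {g : ℕ → Option (List Bool × List Bool)}
    {Φ : TuringFunctional} (hg : Enumerates g Φ) (hgc : Computable g) (a b : ℕ)
    (h : ∀ n, ∃ m, (a : ℝ≥0∞) < b * lebesgue (producers g n m)) :
    ∃ m : ℕ → ℕ, Computable m ∧ ∀ n, (a : ℝ≥0∞) < b * lebesgue (producers g n (m n)) := by
  have key : ∀ n m, (a : ℝ≥0∞) < b * lebesgue (producers g n m) ↔
      a * 2 ^ m < b * ∑ j ∈ Finset.range (2 ^ n), produceCount g m (bitString n j) := by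
    intro n m
    rw [hg.lebesgue_producers, ← ENNReal.mul_lt_mul_iff_right (a := 2 ^ m) (by simp) (by simp)]
    set s := ∑ j ∈ Finset.range (2 ^ n), produceCount g m (bitString n j)
    have e1 : (2 : ℝ≥0∞) ^ m * (b * (s * 2⁻¹ ^ m)) = b * s * (2 ^ m * 2⁻¹ ^ m) := by ring
    rw [e1, two_pow_mul_half_pow_self, mul_one, mul_comm]
    norm_cast
  simp_rw [key] at h ⊢
  have hc : Computable fun q : ℕ × ℕ =>
      ∑ j ∈ Finset.range (2 ^ q.1), produceCount g q.2 (bitString q.1 j) := by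
    refine computable_sum (f := fun (q : ℕ × ℕ) j => produceCount g q.2 (bitString q.1 j)) ?_
      (computable_two_pow Computable.fst)
    have h1 : Computable fun q : (ℕ × ℕ) × ℕ => q.1.2 := Computable.snd.comp Computable.fst
    have h2 : Computable fun q : (ℕ × ℕ) × ℕ => bitString q.1.1 q.2 :=
      computable_bitString.comp (Computable.fst.comp Computable.fst) Computable.snd
    exact computable_produceCount hgc h1 h2
  refine ⟨fun n => Nat.find (h n), Computable.find (Computable.computablePred ?_) h,
    fun n => Nat.find_spec (h n)⟩
  exact computable_decide_lt (computable_mul (Computable.const a)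
    (computable_two_pow Computable.snd)) (computable_mul (Computable.const b) hc)

theorem not_stronglyDeep_of_frequently {U : Machine} {Y : Cantor} {t : ℕ → ℕ} (ht : Computable t)
    (htm : Monotone t) (a : ℕ)
    (h : ∃ᶠ n in atTop,
      U.timeComplexity t (restrict Y n) ≤ U.complexity (restrict Y n) + a) :
    ¬ StronglyDeep U Y := by
  intro hd
  have hev := (hd t ht htm).eventually (lt_mem_nhds (ENat.natCast_lt_top a))
  obtain ⟨n, hn, hlt⟩ := (h.and_eventually hev).exists
  exact absurd (tsub_le_iff_left.2 hn) (not_le.2 hlt)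

theorem exists_nat_div_approx {x δ : ℝ≥0∞} (hx : x ≠ 0) (hx' : x ≠ ∞) (hδ : δ ≠ 0) :
    ∃ a b : ℕ, 0 < b ∧ (a : ℝ≥0∞) < b * x ∧ x ≤ a / b + δ := by
  obtain ⟨q, hq, h1, h2⟩ := ENNReal.lt_iff_exists_rat_btwn.1 (ENNReal.sub_lt_self hx' hx hδ)
  have hb : (q.den : ℝ≥0∞) ≠ 0 := by exact_mod_cast q.den_nz
  have e1 : (Real.toNNReal q : ℝ≥0∞) = (q.num.toNat : ℝ≥0∞) / q.den := by
    have e2 : Real.toNNReal q = (q.num.toNat : NNReal) / q.den := by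
      ext
      have e3 : ((q.num.toNat : ℕ) : ℝ) = ((q.num : ℤ) : ℝ) := by
        exact_mod_cast Int.toNat_of_nonneg (Rat.num_nonneg.2 hq)
      rw [Real.coe_toNNReal _ (by exact_mod_cast hq), NNReal.coe_div, NNReal.coe_natCast,
        NNReal.coe_natCast, e3]
      exact Rat.cast_def q
    rw [e2, ENNReal.coe_div (by exact_mod_cast q.den_nz)]
    simp
  rw [e1] at h1 h2
  refine ⟨q.num.toNat, q.den, q.den_pos, ?_, tsub_le_iff_right.1 h1.le⟩
  rw [mul_comm]
  exact (ENNReal.div_lt_iff (Or.inl hb) (Or.inl (by simp))).1 h2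

theorem lebesgue_deepOracles_le (U : Machine) (hU : U.IsUniversal) (Φ : TuringFunctional)
    (δ : ℝ≥0∞) (hδ : 0 < δ) : lebesgue (deepOracles U Φ) ≤ 3 * δ := by
  obtain ⟨e, he, htime, hcompl⟩ := U.exists_universalRequests hU
  obtain ⟨c, hc⟩ := he.frequently_lengthMass_le
  obtain ⟨g, hgc, hg⟩ := exists_enumeration Φ.re
  replace hg : Enumerates g Φ := hg
  obtain ⟨ℓ, hℓc, hℓ⟩ := exists_computable_codeLength
  let T : ℕ → Set Cantor := fun n => ⋃ m, producers g n m
  have hTm : ∀ n, MeasurableSet (T n) := fun n =>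
    MeasurableSet.iUnion fun m => measurableSet_producers g n m
  have hTanti : Antitone T := fun n n' h => Set.iUnion_mono fun m => producers_anti g m h
  let D : Set Cantor := ⋂ n, T n
  have hsub : deepOracles U Φ ⊆ D := by
    rintro X ⟨Y, hXY, _⟩
    refine Set.mem_iInter.2 fun n => ?_
    obtain ⟨m, hm⟩ := hg.mem_producers hXY n
    exact Set.mem_iUnion.2 ⟨m, hm⟩
  rcases eq_or_ne (lebesgue D) 0 with h0 | h0
  · exact (measure_mono hsub).trans (h0.le.trans zero_le)
  obtain ⟨a, b, hb, hab, hab'⟩ : ∃ a b : ℕ, 0 < b ∧ (a : ℝ≥0∞) < b * lebesgue D ∧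
      lebesgue D ≤ a / b + δ :=
    exists_nat_div_approx h0 (measure_ne_top _ _) hδ.ne'
  have hstage : ∀ n, ∃ m, (a : ℝ≥0∞) < b * lebesgue (producers g n m) := by
    intro n
    have h1 : (a : ℝ≥0∞) < b * lebesgue (T n) :=
      hab.trans_le (by gcongr; exact Set.iInter_subset _ _)
    rw [(producers_mono g n).measure_iUnion, ENNReal.mul_iSup] at h1
    exact lt_iSup_iff.1 h1
  obtain ⟨m, hm, hgm⟩ := hg.exists_computable_stage hgc a b hstage
  -- `A` is the deficiency beyond which compressible outputs have probability at most `δ`.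
  obtain ⟨A, hA⟩ : ∃ A : ℕ, (2 : ℝ≥0∞) ^ (2 * c + 1) * 2⁻¹ ^ A ≤ δ := by
    obtain ⟨A, hA⟩ := ENNReal.exists_inv_two_pow_lt
      (a := δ / 2 ^ (2 * c + 1)) (ENNReal.div_pos hδ.ne' (by simp)).ne'
    refine ⟨A, ?_⟩
    rw [mul_comm]
    exact (ENNReal.le_div_iff_mul_le (by simp) (by simp)).1 hA.le
  obtain ⟨c', t, ht, htm, hserve⟩ := he.exists_time_bound
    (computable_outputRequests he.computable hgc hℓc hm)
    (hg.tsum_outputRequests_le he.tsum_le m hℓ)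
  let good : ℕ → Prop := fun n => ∃ d τ, e n = some (d, τ) ∧
    2 ^ d * lengthMass e n ≤ 2 ^ (2 * c)
  let bad : ℕ → Set Cantor := fun n => {X | ∃ d τ, e n = some (d, τ) ∧
    X ∈ compressible e g n (m n) A fun j => d + ℓ (m n) (produceCount g (m n) (bitString n j))}
  have hbad : ∀ n, good n → lebesgue (bad n) ≤ δ := by
    rintro n ⟨d, τ, hn, hle⟩
    refine le_trans (measure_mono ?_) ((lebesgue_compressible_le (m := m n) (a := A) (g := g)
      hℓ hle).trans hA)
    rintro X ⟨d', τ', hn', hX⟩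
    rw [hn] at hn'
    obtain ⟨rfl, rfl⟩ := Prod.mk.inj (Option.some.inj hn')
    exact hX
  -- These are the oracles that avoid the successful event at every good length from `N` on. The
  -- sets increase with `N`, so a bound on their measures that is uniform in `N` passes to the
  -- union.
  let S : ℕ → Set Cantor := fun N =>
    {X | X ∈ D ∧ ∀ n, N ≤ n → good n → X ∉ producers g n (m n) \ bad n}
  have hSmono : Monotone S := by
    rintro N N' h X ⟨hX, hX'⟩
    exact ⟨hX, fun n hn => hX' n (h.trans hn)⟩
  have hdeep : deepOracles U Φ ⊆ ⋃ N, S N := by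
    rintro X hX
    obtain ⟨Y, hXY, hY⟩ := id hX
    by_contra hno
    refine not_stronglyDeep_of_frequently ht htm (A + c') ?_ hY
    rw [frequently_atTop]
    intro N
    have hN : X ∉ S N := fun h => hno (Set.mem_iUnion.2 ⟨N, h⟩)
    have hN' : ∃ n, N ≤ n ∧ good n ∧ X ∈ producers g n (m n) \ bad n := by
      by_contra hcon
      push Not at hcon
      exact hN ⟨hsub hX, hcon⟩
    obtain ⟨n, hn, ⟨d, τ₀, hen, _⟩, ⟨τ, rfl, hτ⟩, hnb⟩ := hN'
    refine ⟨τ.length, hn, ?_⟩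
    obtain ⟨j, hj, hjτ⟩ := exists_bitString_eq τ
    rw [← hg.eq_restrict hXY hτ]
    set n := τ.length with hnτ
    set L := d + ℓ (m n) (produceCount g (m n) (bitString n j)) with hL
    have hreq : outputRequests e g ℓ m n j = some (L, τ) := by
      rw [outputRequests, if_pos ⟨hj, hjτ.symm ▸ produceCount_pos hτ⟩, hen]
      simp [hL, hjτ]
    obtain ⟨k, d', hk, hle, hkt⟩ := hserve n j L τ hj hreq
    have h1 : U.timeComplexity t τ ≤ d' := htime k d' τ hk t hkt
    -- A program of length below `L - A` would put `X` into `bad n`.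
    have h2 : ((L - A : ℕ) : ℕ∞) ≤ U.complexity τ := by
      refine hcompl τ _ fun k d' hk => ?_
      by_contra hlt
      rw [not_le, Nat.cast_lt] at hlt
      refine hnb ⟨d, τ₀, hen, j, hj, hjτ.symm ▸ hτ, k, d', hjτ.symm ▸ hk, ?_⟩
      dsimp only
      omega
    calc U.timeComplexity t τ ≤ d' := h1
      _ ≤ ((L - A : ℕ) : ℕ∞) + ((A + c' : ℕ) : ℕ∞) := by
          rw [← Nat.cast_add, Nat.cast_le]; omega
      _ ≤ U.complexity τ + ((A + c' : ℕ) : ℕ∞) := by gcongr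
  have hlim : Tendsto (fun n => lebesgue (T n)) atTop (𝓝 (lebesgue D)) :=
    tendsto_measure_iInter_atTop (fun n => (hTm n).nullMeasurableSet) hTanti
      ⟨0, measure_ne_top _ _⟩
  have hev : ∀ᶠ n in atTop, lebesgue (T n) < lebesgue D + δ :=
    hlim.eventually (gt_mem_nhds (ENNReal.lt_add_right (measure_ne_top _ _) hδ.ne'))
  -- One good length `n ≥ N` suffices. The three errors `δ` come from replacing `D` by `T n`, from
  -- approximating the measure of `D` by `a / b`, and from the compressible outputs.
  have hS : ∀ N, lebesgue (S N) ≤ 3 * δ := by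
    intro N
    obtain ⟨n, hgood, hTn, hn⟩ :=
      (hc.and_eventually (hev.and (eventually_ge_atTop N))).exists
    have hG : producers g n (m n) ⊆ T n := Set.subset_iUnion (producers g n) (m n)
    have hincl : S N ⊆ (T n \ producers g n (m n)) ∪ bad n := by
      rintro X ⟨hX, hX'⟩
      have h1 := hX' n hn hgood
      by_cases hp : X ∈ producers g n (m n)
      · exact Or.inr (by_contra fun hb => h1 ⟨hp, hb⟩)
      · exact Or.inl ⟨Set.mem_iInter.1 hX n, hp⟩
    have hle : (a : ℝ≥0∞) / b ≤ lebesgue (producers g n (m n)) := by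
      rw [ENNReal.div_le_iff (by exact_mod_cast hb.ne') (by simp), mul_comm]
      exact (hgm n).le
    have hdiff : lebesgue (T n \ producers g n (m n)) ≤ 2 * δ := by
      rw [measure_sdiff hG (measurableSet_producers _ _ _).nullMeasurableSet (measure_ne_top _ _),
        tsub_le_iff_left]
      calc lebesgue (T n) ≤ lebesgue D + δ := hTn.le
        _ ≤ a / b + δ + δ := by gcongr
        _ = a / b + 2 * δ := by ring
        _ ≤ _ := by gcongr
    calc lebesgue (S N) ≤ lebesgue (T n \ producers g n (m n)) + lebesgue (bad n) :=
          (measure_mono hincl).trans (measure_union_le _ _)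
      _ ≤ 2 * δ + δ := add_le_add hdiff (hbad n hgood)
      _ = 3 * δ := by ring
  calc lebesgue (deepOracles U Φ) ≤ lebesgue (⋃ N, S N) := measure_mono hdeep
    _ = ⨆ N, lebesgue (S N) := hSmono.measure_iUnion
    _ ≤ 3 * δ := iSup_le hS

theorem lebesgue_deepOracles (U : Machine) (hU : U.IsUniversal) (Φ : TuringFunctional) :
    lebesgue (deepOracles U Φ) = 0 := by
  refine le_antisymm (ENNReal.le_of_forall_pos_le_add fun ε hε _ => ?_) zero_le
  refine (lebesgue_deepOracles_le U hU Φ (ε / 3) ?_).trans ?_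
  · exact ENNReal.div_pos (by exact_mod_cast hε.ne') (by simp)
  · rw [ENNReal.mul_div_cancel (by simp) (by simp), zero_add]

/-- A graph is the domain of a partial recursive function, hence determined by a code; this reduces
negligibility to one functional at a time. -/
instance : Countable TuringFunctional := by
  have hex : ∀ Φ : TuringFunctional, ∃ c : Nat.Partrec.Code, ∀ p : List Bool × List Bool,
      (c.eval (Encodable.encode p)).Dom ↔ p ∈ Φ.graph := by
    intro Φ
    obtain ⟨c, hc⟩ := Nat.Partrec.Code.exists_code.1 Φ.re
    refine ⟨c, fun p => ?_⟩
    rw [hc]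
    simp [Part.assert]
  choose code hcode using hex
  refine Function.Injective.countable (f := code) fun Φ Ψ h => ?_
  have h2 : Φ.graph = Ψ.graph := by
    ext p
    rw [← hcode Φ, ← hcode Ψ, h]
  cases Φ
  cases Ψ
  cases h2
  rfl

end DeepSeq

theorem mainTheorem2 (U : DeepSeq.Machine) (hU : U.IsUniversal) :
    DeepSeq.Negligible {Y : DeepSeq.Cantor | DeepSeq.StronglyDeep U Y} := by
  have h : {X | ∃ (Φ : DeepSeq.TuringFunctional) (Y : DeepSeq.Cantor), Φ.Maps X Y ∧
      Y ∈ {Y : DeepSeq.Cantor | DeepSeq.StronglyDeep U Y}} =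
      ⋃ Φ, DeepSeq.deepOracles U Φ := by
    ext X
    simp [DeepSeq.deepOracles]
  rw [DeepSeq.Negligible, h, MeasureTheory.measure_iUnion_null_iff]
  exact DeepSeq.lebesgue_deepOracles U hU
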